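/- All manifolds are real, finite-dimensional, Hausdorff, second countable and connected, and all maps are smooth. Let $\pi:Y\to X$ be a fibre bundle, $n=\dim X$, with fibred coordinates $(x^\lambda,y^i)$, let $J^1Y$ be its first order jet manifold with coordinates $(x^\lambda,y^i,y^i_\lambda)$, and let $$\Pi=\textstyle\bigwedge^nT^*X\otimes_Y V^*Y\otimes_Y TX\to Y$$ be the Legendre bundle with coordinates $(x^\lambda,y^i,p^\lambda_i)$. Let $L=\mathcal L\,\omega:J^1Y\to\bigwedge^nT^*X$, $\omega=dx^1\wedge\dots\wedge dx^n$, be a Lagrangian, i.e. a bundle map over $X$. Its Legendre map $\widehat L:J^1Y\to\Pi$ is the map over $Y$ with $p^\lambda_i\circ\widehat L=\pi^\lambda_i:=\partial\mathcal L/\partial y^i_\lambda$, its Lagrangian constraint space is $N_L=\widehat L(J^1Y)\subset\Pi$, and its Poincaré–Cartan form is the $n$-form $$H_L=\mathcal L\,\omega+\pi^\lambda_i\,(dy^i-y^i_\mu dx^\mu)\wedge\omega_\lambda,\qquad \omega_\lambda=\partial_\lambda\rfloor\omega,$$ on $J^1Y$. Suppose that $L$ is almost regular, i.e. (i) $N_L$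 is a closed imbedded subbundle of $\Pi\to Y$, and (ii) $\widehat L:J^1Y\to N_L$ is a fibred manifold (a surjective submersion) with connected fibres. Suppose moreover that $\widehat L:J^1Y\to N_L$ admits a global section, let $\Psi:N_L\to J^1Y$ be any such section, and put $H_N=\Psi^*H_L$. Then a section $\overline s$ of $J^1Y\to X$ is a solution of the Cartan equations, i.e. $$\overline s^*(u\rfloor dH_L)=0\quad\text{for every vertical vector field } u \text{ on } J^1Y\to X,$$ if and only if the section $r=\widehat L\circ\overline s$ of $N_L\to X$ is a solution of the constrained Hamilton equations, i.e. $$r^*(u_N\rfloor dH_N)=0\quad\text{for every vertical vector field } u_N \text{ on } N_L\to X.$$ -/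

import Mathlib

open Set Function Topology
open scoped Manifold ContDiff

noncomputable section

namespace JetField

universe u v

/-- `ℝⁿ` with its standard basis. -/
abbrev Eu (n : ℕ) := EuclideanSpace ℝ (Fin n)

/-- Alternating `n`-forms on `ℝⁿ`. Since Mathlib's tangent space of an `n`-manifold at a point is the
model space `Eu n`, this is also the fibre `⋀ⁿ T*ₓX` at every point `x` of an `n`-manifold `X`. -/
abbrev TopForm (n : ℕ) := Eu n [⋀^Fin n]→L[ℝ] ℝ

/-- `p : Z → B` is a smooth (locally trivial) fibre bundle with `k`-dimensional typical fibre `M`: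
a smooth surjection with smooth local trivializations. `Z` is modelled on `G × ℝᵏ`, where `G` is the
model space of `B`. -/
class IsSmoothFibreBundle (G : Type*) [NormedAddCommGroup G] [NormedSpace ℝ G] (k : ℕ)
    {B : Type v} [TopologicalSpace B] [ChartedSpace G B]
    {Z : Type u} [TopologicalSpace Z] [ChartedSpace (G × Eu k) Z] (p : Z → B) : Prop where
  contMDiff : ContMDiff 𝓘(ℝ, G × Eu k) 𝓘(ℝ, G) ∞ p
  surjective : Surjective p
  locallyTrivial : ∃ (M : Type u) (_ : TopologicalSpace M) (_ : ChartedSpace (Eu k) M),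
    IsManifold 𝓘(ℝ, Eu k) ∞ M ∧ ∀ b : B, ∃ e : Bundle.Trivialization M p, b ∈ e.baseSet ∧
      ContMDiffOn 𝓘(ℝ, G × Eu k) (𝓘(ℝ, G).prod 𝓘(ℝ, Eu k)) ∞ e e.source ∧
      ContMDiffOn (𝓘(ℝ, G).prod 𝓘(ℝ, Eu k)) 𝓘(ℝ, G × Eu k) ∞
        e.toOpenPartialHomeomorph.symm e.target

/-- The differential `T_x f : T_x M → T_{f x} N`; in Mathlib the tangent spaces of manifolds without
boundary modelled on `E` and `F` are, as vector spaces, `E` and `F`. -/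
def dAt (E F : Type*) [NormedAddCommGroup E] [NormedSpace ℝ E] [NormedAddCommGroup F]
    [NormedSpace ℝ F] {M N : Type*} [TopologicalSpace M] [ChartedSpace E M] [TopologicalSpace N]
    [ChartedSpace F N] (f : M → N) (x : M) : E →L[ℝ] F :=
  mfderiv 𝓘(ℝ, E) 𝓘(ℝ, F) f x

section
variable {n m : ℕ} {X : Type v} {Y : Type u} [TopologicalSpace X] [ChartedSpace (Eu n) X]
  [TopologicalSpace Y] [ChartedSpace (Eu n × Eu m) Y]

variable (n m) in
/-- Fibred coordinates `(x^λ, y^i)` on `π : Y → X`: a smooth chart `tot` of `Y` and a smooth chart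
`base` of `X` such that `π` reads `(x, y) ↦ x`. -/
structure FibredChart (π : Y → X) where
  tot : OpenPartialHomeomorph Y (Eu n × Eu m)
  base : OpenPartialHomeomorph X (Eu n)
  tot_smooth : ContMDiffOn 𝓘(ℝ, Eu n × Eu m) 𝓘(ℝ, Eu n × Eu m) ∞ tot tot.source
  tot_symm_smooth : ContMDiffOn 𝓘(ℝ, Eu n × Eu m) 𝓘(ℝ, Eu n × Eu m) ∞ tot.symm tot.target
  base_smooth : ContMDiffOn 𝓘(ℝ, Eu n) 𝓘(ℝ, Eu n) ∞ base base.source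
  base_symm_smooth : ContMDiffOn 𝓘(ℝ, Eu n) 𝓘(ℝ, Eu n) ∞ base.symm base.target
  proj_mem : ∀ y ∈ tot.source, π y ∈ base.source
  fst_tot : ∀ y ∈ tot.source, (tot y).1 = base (π y)

theorem exists_fibredChart [IsManifold 𝓘(ℝ, Eu n) ∞ X] (π : Y → X)
    [h : IsSmoothFibreBundle (Eu n) m π] (y : Y) :
    ∃ c : FibredChart n m π, y ∈ c.tot.source := by
  obtain ⟨M, _, _, hM, H⟩ := h.locallyTrivial
  obtain ⟨e, hb, he, he'⟩ := H (π y)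
  have hy : y ∈ e.source := by rw [e.source_eq]; exact hb
  let d : OpenPartialHomeomorph (X × M) (Eu n × Eu m) :=
    (chartAt (Eu n) (π y)).prod (chartAt (Eu m) (e y).2)
  have hd : ContMDiffOn (𝓘(ℝ, Eu n).prod 𝓘(ℝ, Eu m)) 𝓘(ℝ, Eu n × Eu m) ∞ d d.source := by
    rw [modelWithCornersSelf_prod, ← chartedSpaceSelf_prod]
    exact (contMDiffOn_chart (I := 𝓘(ℝ, Eu n))).prodMap (contMDiffOn_chart (I := 𝓘(ℝ, Eu m)))
  have hd' : ContMDiffOn 𝓘(ℝ, Eu n × Eu m) (𝓘(ℝ, Eu n).prod 𝓘(ℝ, Eu m)) ∞ d.symm d.target := by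
    rw [modelWithCornersSelf_prod, ← chartedSpaceSelf_prod]
    exact (contMDiffOn_chart_symm (I := 𝓘(ℝ, Eu n))).prodMap
      (contMDiffOn_chart_symm (I := 𝓘(ℝ, Eu m)))
  have hs : ∀ z, z ∈ (e.toOpenPartialHomeomorph.trans d).source →
      z ∈ e.source ∧ e z ∈ d.source := by
    intro z hz
    rw [OpenPartialHomeomorph.trans_source] at hz
    exact hz
  have hds : ∀ w : X × M, w ∈ d.source → w.1 ∈ (chartAt (Eu n) (π y)).source := by
    intro w hw
    exact hw.1
  refine ⟨⟨e.toOpenPartialHomeomorph.trans d, chartAt (Eu n) (π y), ?_, ?_,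
    contMDiffOn_chart, contMDiffOn_chart_symm, ?_, ?_⟩, ?_⟩
  · exact hd.comp (he.mono fun z hz => (hs z hz).1) fun z hz => (hs z hz).2
  · refine he'.comp (hd'.mono ?_) ?_
    · intro z hz; rw [OpenPartialHomeomorph.trans_target] at hz; exact hz.1
    · intro z hz; rw [OpenPartialHomeomorph.trans_target] at hz; exact hz.2
  · intro z hz
    rw [← e.coe_fst (hs z hz).1]
    exact hds _ (hs z hz).2
  · intro z hz
    rw [← e.coe_fst (hs z hz).1]; rfl
  · rw [OpenPartialHomeomorph.trans_source]
    refine ⟨hy, ?_⟩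
    refine ⟨?_, ?_⟩
    · change (e y).1 ∈ _
      rw [e.coe_fst hy]; exact mem_chart_source _ _
    · exact mem_chart_source _ _

variable (n m) in
/-- A point of the first order jet manifold `J¹Y` of `π : Y → X`: a point `y` of `Y` together with the
differential `T_{π y}X → T_yY` at `π y` of a local section of `π` through `y`, i.e. a linear right
inverse of `T_yπ`. -/
@[ext]
structure Jet (π : Y → X) where
  pt : Y
  lin : Eu n →L[ℝ] Eu n × Eu m
  proj_lin : (dAt (Eu n × Eu m) (Eu n) π pt).comp lin = ContinuousLinearMap.id ℝ (Eu n)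

variable (n m) in
/-- The vertical tangent space `V_yY = ker (T_yπ)`. -/
abbrev Vert (π : Y → X) (y : Y) : Submodule ℝ (Eu n × Eu m) :=
  LinearMap.ker (dAt (Eu n × Eu m) (Eu n) π y).toLinearMap

variable (n m) in
/-- A point of the Legendre bundle `Π = ⋀ⁿT*X ⊗ V*Y ⊗ TX` over `Y`: a point `y` of `Y` and an element
of the fibre, where we use the canonical isomorphism
`⋀ⁿT*ₓX ⊗ V*_yY ⊗ TₓX ≅ Hom (Hom (TₓX, V_yY), ⋀ⁿT*ₓX)`, `x = π y`. The element with coordinates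
`p^λ_i` corresponds to `φ ↦ p^λ_i φ^i_λ dx¹ ∧ ⋯ ∧ dxⁿ`. -/
structure LegendrePoint (π : Y → X) where
  pt : Y
  mom : (Eu n →L[ℝ] Vert n m π pt) →L[ℝ] TopForm n

/-- The form `dx¹ ∧ ⋯ ∧ dxⁿ` on `ℝⁿ`. -/
def stdVol (n : ℕ) : TopForm n :=
  { (EuclideanSpace.basisFun (Fin n) ℝ).toBasis.det with
    cont := by
      change Continuous fun v : Fin n → Eu n => (EuclideanSpace.basisFun (Fin n) ℝ).toBasis.det v
      simp only [Module.Basis.det_apply]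
      refine Continuous.matrix_det ?_
      refine continuous_matrix fun i j => ?_
      simp [Module.Basis.toMatrix_apply]
      fun_prop }

/-- The standard basis of `ℝⁿ`. -/
def stdVec (n : ℕ) : Fin n → Eu n := fun i => EuclideanSpace.single i 1

theorem TopForm.eq_smul {n : ℕ} (η : TopForm n) : η = η (stdVec n) • stdVol n := by
  ext v
  have := congrArg (fun f => f v) (η.toAlternatingMap.eq_smul_basis_det (EuclideanSpace.basisFun (Fin n) ℝ).toBasis)
  simp at this
  have h2 : (⇑(EuclideanSpace.basisFun (Fin n) ℝ) : Fin n → Eu n) = stdVec n := by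
    ext i j; simp [stdVec]
  simp [h2] at this
  exact this

theorem stdVol_stdVec (n : ℕ) : stdVol n (stdVec n) = 1 := by
  have := (EuclideanSpace.basisFun (Fin n) ℝ).toBasis.det_self
  have h2 : (⇑(EuclideanSpace.basisFun (Fin n) ℝ).toBasis : Fin n → Eu n) = stdVec n := by
    ext i j; simp [stdVec]
  rw [h2] at this
  exact this

end

section general
variable {E F F' : Type*} [NormedAddCommGroup E] [NormedSpace ℝ E] [NormedAddCommGroup F]
  [NormedSpace ℝ F] [NormedAddCommGroup F'] [NormedSpace ℝ F']
  {M N N' : Type*} [TopologicalSpace M] [ChartedSpace E M] [TopologicalSpace N] [ChartedSpace F N]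
  [TopologicalSpace N'] [ChartedSpace F' N']

theorem dAt_comp {g : N → N'} {f : M → N} {x : M} (hg : MDifferentiableAt 𝓘(ℝ, F) 𝓘(ℝ, F') g (f x))
    (hf : MDifferentiableAt 𝓘(ℝ, E) 𝓘(ℝ, F) f x) :
    dAt E F' (g ∘ f) x = (dAt F F' g (f x)).comp (dAt E F f x) :=
  mfderiv_comp x hg hf

theorem dAt_id (x : M) : dAt E E (id : M → M) x = ContinuousLinearMap.id ℝ E :=
  mfderiv_id

theorem dAt_congr {f g : M → N} {x : M} (h : f =ᶠ[𝓝 x] g) : dAt E F f x = dAt E F g x := by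
  have := h.mfderiv_eq (I := 𝓘(ℝ, E)) (I' := 𝓘(ℝ, F))
  exact this

theorem dAt_eq_fderiv (f : E → F) (x : E) : dAt E F f x = fderiv ℝ f x := mfderiv_eq_fderiv

theorem mdiffAt_of_smoothOn {f : M → N} {s : Set M} (h : ContMDiffOn 𝓘(ℝ, E) 𝓘(ℝ, F) ∞ f s)
    (hs : IsOpen s) {x : M} (hx : x ∈ s) : MDifferentiableAt 𝓘(ℝ, E) 𝓘(ℝ, F) f x :=
  (h.contMDiffAt (hs.mem_nhds hx)).mdifferentiableAt (by simp)

theorem dAt_symm_comp (A : OpenPartialHomeomorph M E)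
    (hA : ContMDiffOn 𝓘(ℝ, E) 𝓘(ℝ, E) ∞ A A.source)
    (hA' : ContMDiffOn 𝓘(ℝ, E) 𝓘(ℝ, E) ∞ A.symm A.target)
    {y : M} (hy : y ∈ A.source) :
    (dAt E E A.symm (A y)).comp (dAt E E A y) = ContinuousLinearMap.id ℝ E := by
  rw [← dAt_comp (mdiffAt_of_smoothOn hA' A.open_target (A.map_source hy))
    (mdiffAt_of_smoothOn hA A.open_source hy), ← dAt_id y]
  exact dAt_congr (Filter.eventuallyEq_of_mem (A.open_source.mem_nhds hy) fun z hz => A.left_inv hz)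

theorem dAt_comp_symm (A : OpenPartialHomeomorph M E)
    (hA : ContMDiffOn 𝓘(ℝ, E) 𝓘(ℝ, E) ∞ A A.source)
    (hA' : ContMDiffOn 𝓘(ℝ, E) 𝓘(ℝ, E) ∞ A.symm A.target)
    {y : M} (hy : y ∈ A.source) :
    (dAt E E A y).comp (dAt E E A.symm (A y)) = ContinuousLinearMap.id ℝ E := by
  have h := A.left_inv hy
  have := dAt_comp (g := A) (f := A.symm) (x := A y) (E := E) (F := E) (F' := E)
    (by rw [h]; exact mdiffAt_of_smoothOn hA A.open_source hy)
    (mdiffAt_of_smoothOn hA' A.open_target (A.map_source hy))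
  rw [h] at this
  rw [← this, ← dAt_id (A y)]
  exact dAt_congr (Filter.eventuallyEq_of_mem (A.open_target.mem_nhds (A.map_source hy))
    fun z hz => A.right_inv hz)

theorem contDiffOn_transition (A B : OpenPartialHomeomorph M E)
    (hA' : ContMDiffOn 𝓘(ℝ, E) 𝓘(ℝ, E) ∞ A.symm A.target)
    (hB : ContMDiffOn 𝓘(ℝ, E) 𝓘(ℝ, E) ∞ B B.source) :
    ContDiffOn ℝ ∞ (B ∘ A.symm) (A.symm.trans B).source := by
  rw [← contMDiffOn_iff_contDiffOn]
  rw [OpenPartialHomeomorph.trans_source]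
  exact hB.comp (hA'.mono inter_subset_left) inter_subset_right

theorem fderiv_transition (A B : OpenPartialHomeomorph M E)
    (hA' : ContMDiffOn 𝓘(ℝ, E) 𝓘(ℝ, E) ∞ A.symm A.target)
    (hB : ContMDiffOn 𝓘(ℝ, E) 𝓘(ℝ, E) ∞ B B.source)
    {q : E} (hq : q ∈ A.target) (hq' : A.symm q ∈ B.source) :
    fderiv ℝ (B ∘ A.symm) q = (dAt E E B (A.symm q)).comp (dAt E E A.symm q) := by
  rw [← dAt_eq_fderiv]
  exact dAt_comp (mdiffAt_of_smoothOn hB B.open_source hq')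
    (mdiffAt_of_smoothOn hA' A.open_target hq)

end general

variable {n m : ℕ} {X : Type v} {Y : Type u} [TopologicalSpace X] [ChartedSpace (Eu n) X]
  [TopologicalSpace Y] [ChartedSpace (Eu n × Eu m) Y] {π : Y → X}

namespace FibredChart

variable (c c' : FibredChart n m π)

theorem base_symm_dAt {x : X} (hx : x ∈ c.base.source) :
    (dAt (Eu n) (Eu n) c.base.symm (c.base x)).comp (dAt (Eu n) (Eu n) c.base x) = .id ℝ _ :=
  dAt_symm_comp _ c.base_smooth c.base_symm_smooth hx

theorem base_dAt_symm {x : X} (hx : x ∈ c.base.source) :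
    (dAt (Eu n) (Eu n) c.base x).comp (dAt (Eu n) (Eu n) c.base.symm (c.base x)) = .id ℝ _ :=
  dAt_comp_symm _ c.base_smooth c.base_symm_smooth hx

theorem tot_symm_dAt {y : Y} (hy : y ∈ c.tot.source) :
    (dAt (Eu n × Eu m) (Eu n × Eu m) c.tot.symm (c.tot y)).comp
      (dAt (Eu n × Eu m) (Eu n × Eu m) c.tot y) = .id ℝ _ :=
  dAt_symm_comp _ c.tot_smooth c.tot_symm_smooth hy

theorem tot_dAt_symm {y : Y} (hy : y ∈ c.tot.source) :
    (dAt (Eu n × Eu m) (Eu n × Eu m) c.tot y).comp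
      (dAt (Eu n × Eu m) (Eu n × Eu m) c.tot.symm (c.tot y)) = .id ℝ _ :=
  dAt_comp_symm _ c.tot_smooth c.tot_symm_smooth hy

theorem proj_eq {y : Y} (hy : y ∈ c.tot.source) : π y = c.base.symm (c.tot y).1 := by
  rw [c.fst_tot y hy, c.base.left_inv (c.proj_mem y hy)]

theorem mdiffAt_proj {y : Y} (hy : y ∈ c.tot.source) :
    MDifferentiableAt 𝓘(ℝ, Eu n × Eu m) 𝓘(ℝ, Eu n) π y := by
  have h1 : MDifferentiableAt 𝓘(ℝ, Eu n × Eu m) 𝓘(ℝ, Eu n) (c.base.symm ∘ (Prod.fst ∘ c.tot)) y := by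
    refine MDifferentiableAt.comp (I' := 𝓘(ℝ, Eu n)) y ?_ (MDifferentiableAt.comp (I' := 𝓘(ℝ, Eu n × Eu m)) y ?_ ?_)
    · refine mdiffAt_of_smoothOn c.base_symm_smooth c.base.open_target ?_
      change (c.tot y).1 ∈ _
      rw [c.fst_tot y hy]; exact c.base.map_source (c.proj_mem y hy)
    · exact differentiableAt_fst.mdifferentiableAt
    · exact mdiffAt_of_smoothOn c.tot_smooth c.tot.open_source hy
  exact h1.congr_of_eventuallyEq (Filter.eventuallyEq_of_mem (c.tot.open_source.mem_nhds hy)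
    fun z hz => c.proj_eq hz)

theorem fst_comp_dAt {y : Y} (hy : y ∈ c.tot.source) :
    (ContinuousLinearMap.fst ℝ (Eu n) (Eu m)).comp (dAt (Eu n × Eu m) (Eu n × Eu m) c.tot y) =
      (dAt (Eu n) (Eu n) c.base (π y)).comp (dAt (Eu n × Eu m) (Eu n) π y) := by
  rw [← dAt_comp (mdiffAt_of_smoothOn c.base_smooth c.base.open_source (c.proj_mem y hy))
    (c.mdiffAt_proj hy)]
  have : dAt (Eu n × Eu m) (Eu n) (Prod.fst : Eu n × Eu m → Eu n) (c.tot y)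
      = ContinuousLinearMap.fst ℝ (Eu n) (Eu m) := by
    rw [dAt_eq_fderiv, fderiv_fst]
  rw [← this, ← dAt_comp differentiableAt_fst.mdifferentiableAt
    (mdiffAt_of_smoothOn c.tot_smooth c.tot.open_source hy)]
  exact dAt_congr (Filter.eventuallyEq_of_mem (c.tot.open_source.mem_nhds hy)
    fun z hz => c.fst_tot z hz)

theorem dAt_proj_comp_symm {y : Y} (hy : y ∈ c.tot.source) :
    (dAt (Eu n × Eu m) (Eu n) π y).comp (dAt (Eu n × Eu m) (Eu n × Eu m) c.tot.symm (c.tot y)) =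
      (dAt (Eu n) (Eu n) c.base.symm (c.base (π y))).comp
        (ContinuousLinearMap.fst ℝ (Eu n) (Eu m)) := by
  have h1 := c.fst_comp_dAt hy
  have h2 := c.tot_dAt_symm hy
  have h3 := c.base_symm_dAt (c.proj_mem y hy)
  calc _ = ((dAt (Eu n) (Eu n) c.base.symm (c.base (π y))).comp
        (dAt (Eu n) (Eu n) c.base (π y))).comp ((dAt (Eu n × Eu m) (Eu n) π y).comp
        (dAt (Eu n × Eu m) (Eu n × Eu m) c.tot.symm (c.tot y))) := by rw [h3]; rfl
    _ = (dAt (Eu n) (Eu n) c.base.symm (c.base (π y))).comp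
        (((dAt (Eu n) (Eu n) c.base (π y)).comp (dAt (Eu n × Eu m) (Eu n) π y)).comp
        (dAt (Eu n × Eu m) (Eu n × Eu m) c.tot.symm (c.tot y))) := rfl
    _ = (dAt (Eu n) (Eu n) c.base.symm (c.base (π y))).comp
        ((ContinuousLinearMap.fst ℝ (Eu n) (Eu m)).comp
         ((dAt (Eu n × Eu m) (Eu n × Eu m) c.tot y).comp
        (dAt (Eu n × Eu m) (Eu n × Eu m) c.tot.symm (c.tot y)))) := by rw [← h1]; rfl
    _ = _ := by rw [h2]; rfl

/-- The coordinates `(x^λ, y^i, y^i_λ)` of a jet; `y^i_λ` is the matrix of the vertical part of the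
jet in the given fibred chart. -/
def jetCoord (z : Jet n m π) : (Eu n × Eu m) × (Eu n →L[ℝ] Eu m) :=
  (c.tot z.pt, (ContinuousLinearMap.snd ℝ (Eu n) (Eu m)).comp
    ((dAt (Eu n × Eu m) (Eu n × Eu m) c.tot z.pt).comp
      (z.lin.comp (dAt (Eu n) (Eu n) c.base.symm (c.base (π z.pt))))))

/-- The jet at `y` with coordinates `y^i_λ = γ`. -/
def mkJet (y : Y) (hy : y ∈ c.tot.source) (γ : Eu n →L[ℝ] Eu m) : Jet n m π where
  pt := y
  lin := (dAt (Eu n × Eu m) (Eu n × Eu m) c.tot.symm (c.tot y)).comp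
    (((ContinuousLinearMap.id ℝ (Eu n)).prod γ).comp (dAt (Eu n) (Eu n) c.base (π y)))
  proj_lin := by
    rw [← ContinuousLinearMap.comp_assoc, c.dAt_proj_comp_symm hy]
    exact c.base_symm_dAt (c.proj_mem y hy)

theorem mkJet_jetCoord (z : Jet n m π) (hy : z.pt ∈ c.tot.source) :
    c.mkJet z.pt hy (c.jetCoord z).2 = z := by
  ext1
  · rfl
  have h1 := fun v => DFunLike.congr_fun (c.fst_comp_dAt hy) v
  have h2 := fun v => DFunLike.congr_fun (c.tot_symm_dAt hy) v
  have h3 := fun v => DFunLike.congr_fun (c.base_symm_dAt (c.proj_mem _ hy)) v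
  have h4 := fun v => DFunLike.congr_fun z.proj_lin v
  simp only [ContinuousLinearMap.comp_apply, ContinuousLinearMap.id_apply,
    ContinuousLinearMap.coe_fst'] at h1 h2 h3 h4
  ext1 v
  have : (dAt (Eu n) (Eu n) c.base (π z.pt) v,
      (dAt (Eu n × Eu m) (Eu n × Eu m) c.tot z.pt (z.lin v)).2) =
      dAt (Eu n × Eu m) (Eu n × Eu m) c.tot z.pt (z.lin v) := by
    rw [Prod.ext_iff]; simp [h1, h4]
  simp [mkJet, jetCoord, h3, this, h2]

theorem jetCoord_mkJet (y : Y) (hy : y ∈ c.tot.source) (γ : Eu n →L[ℝ] Eu m) :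
    c.jetCoord (c.mkJet y hy γ) = (c.tot y, γ) := by
  have h2 := fun v => DFunLike.congr_fun (c.tot_dAt_symm hy) v
  have h3 := fun v => DFunLike.congr_fun (c.base_dAt_symm (c.proj_mem _ hy)) v
  simp only [ContinuousLinearMap.comp_apply, ContinuousLinearMap.id_apply] at h2 h3
  ext1
  · rfl
  · ext1 v
    simp [jetCoord, mkJet, h2, h3]

/-- The coordinate isomorphism `V_yY → ℝᵐ`, `v ↦ dy^i(v)`. -/
def vertCoord (y : Y) : Vert n m π y →L[ℝ] Eu m :=
  (ContinuousLinearMap.snd ℝ (Eu n) (Eu m)).comp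
    ((dAt (Eu n × Eu m) (Eu n × Eu m) c.tot y).comp (Vert n m π y).subtypeL)

theorem exists_vertCoord_equiv {y : Y} (hy : y ∈ c.tot.source) :
    ∃ e : Vert n m π y ≃L[ℝ] Eu m, (e : Vert n m π y →L[ℝ] Eu m) = c.vertCoord y ∧
      ∀ w, ((e.symm w : Vert n m π y) : Eu n × Eu m) =
        dAt (Eu n × Eu m) (Eu n × Eu m) c.tot.symm (c.tot y) (0, w) := by
  have h1 := fun v => DFunLike.congr_fun (c.fst_comp_dAt hy) v
  have h2 := fun v => DFunLike.congr_fun (c.tot_symm_dAt hy) v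
  have h2' := fun v => DFunLike.congr_fun (c.tot_dAt_symm hy) v
  have h5 := fun v => DFunLike.congr_fun (c.dAt_proj_comp_symm hy) v
  simp only [ContinuousLinearMap.comp_apply, ContinuousLinearMap.id_apply,
    ContinuousLinearMap.coe_fst'] at h1 h2 h2' h5
  let inv : Eu m →L[ℝ] Vert n m π y :=
    ((dAt (Eu n × Eu m) (Eu n × Eu m) c.tot.symm (c.tot y)).comp
      (ContinuousLinearMap.inr ℝ (Eu n) (Eu m))).codRestrict _ (by
        intro w
        rw [LinearMap.mem_ker]
        change dAt (Eu n × Eu m) (Eu n) π y (dAt (Eu n × Eu m) (Eu n × Eu m) c.tot.symm (c.tot y) (0, w)) = 0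
        rw [h5]; simp)
  refine ⟨ContinuousLinearEquiv.equivOfInverse (c.vertCoord y) inv ?_ ?_, ?_, ?_⟩
  · intro v
    apply Subtype.ext
    have hv : dAt (Eu n × Eu m) (Eu n) π y v = 0 := v.2
    have : ((0 : Eu n), (dAt (Eu n × Eu m) (Eu n × Eu m) c.tot y v).2) =
        dAt (Eu n × Eu m) (Eu n × Eu m) c.tot y v := by
      rw [Prod.ext_iff]; simp [h1, hv]
    change dAt (Eu n × Eu m) (Eu n × Eu m) c.tot.symm (c.tot y)
      (0, (dAt (Eu n × Eu m) (Eu n × Eu m) c.tot y v).2) = v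
    rw [this, h2]
  · intro w
    change (dAt (Eu n × Eu m) (Eu n × Eu m) c.tot y
      (dAt (Eu n × Eu m) (Eu n × Eu m) c.tot.symm (c.tot y) (0, w))).2 = w
    rw [h2']
  · ext v; rfl
  · intro w; rfl

end FibredChart

/-- The linear map `β ↦ A ∘ β ∘ B`. -/
def sandwich {U U' W W' : Type*} [NormedAddCommGroup U] [NormedSpace ℝ U] [NormedAddCommGroup U']
    [NormedSpace ℝ U'] [NormedAddCommGroup W] [NormedSpace ℝ W] [NormedAddCommGroup W']
    [NormedSpace ℝ W'] (A : W →L[ℝ] W') (B : U' →L[ℝ] U) : (U →L[ℝ] W) →L[ℝ] (U' →L[ℝ] W') :=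
  (ContinuousLinearMap.compL ℝ U' W W' A).comp ((ContinuousLinearMap.compL ℝ U' U W).flip B)

@[simp] theorem sandwich_apply {U U' W W' : Type*} [NormedAddCommGroup U] [NormedSpace ℝ U]
    [NormedAddCommGroup U'] [NormedSpace ℝ U'] [NormedAddCommGroup W] [NormedSpace ℝ W]
    [NormedAddCommGroup W'] [NormedSpace ℝ W'] (A : W →L[ℝ] W') (B : U' →L[ℝ] U)
    (β : U →L[ℝ] W) : sandwich A B β = A.comp (β.comp B) := rfl

/-- Evaluation of a form at a tuple of vectors. -/
def evalTop {n : ℕ} (v : Fin n → Eu n) : TopForm n →L[ℝ] ℝ :=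
  ContinuousAlternatingMap.apply ℝ (Eu n) ℝ v

theorem stdVol_dAt_base (c : FibredChart n m π) {x : X} (hx : x ∈ c.base.source) :
    stdVol n (fun i => dAt (Eu n) (Eu n) c.base x
      (dAt (Eu n) (Eu n) c.base.symm (c.base x) (stdVec n i))) = 1 := by
  have h3 := fun v => DFunLike.congr_fun (c.base_dAt_symm hx) v
  simp only [ContinuousLinearMap.comp_apply, ContinuousLinearMap.id_apply] at h3
  simp only [h3]
  exact stdVol_stdVec n

/-- The coordinates `p^λ_i` of an element `P` of the Legendre bundle over `y`, as the linear functional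
`β ↦ p^λ_i β^i_λ`, where `P φ = p^λ_i φ^i_λ dx¹ ∧ ⋯ ∧ dxⁿ`. -/
def FibredChart.momCoord (c : FibredChart n m π) (y : Y)
    (P : (Eu n →L[ℝ] Vert n m π y) →L[ℝ] TopForm n) : (Eu n →L[ℝ] Eu m) →L[ℝ] ℝ :=
  (evalTop fun i => dAt (Eu n) (Eu n) c.base.symm (c.base (π y)) (stdVec n i)).comp
    (P.comp (sandwich (c.vertCoord y).inverse (dAt (Eu n) (Eu n) c.base (π y))))

/-- The element of the Legendre bundle over `y` with coordinates `p^λ_i`. -/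
def FibredChart.mkMom (c : FibredChart n m π) (y : Y) (p : (Eu n →L[ℝ] Eu m) →L[ℝ] ℝ) :
    (Eu n →L[ℝ] Vert n m π y) →L[ℝ] TopForm n :=
  (p.comp (sandwich (c.vertCoord y) (dAt (Eu n) (Eu n) c.base.symm (c.base (π y))))).smulRight
    ((stdVol n).compContinuousLinearMap (dAt (Eu n) (Eu n) c.base (π y)))

theorem FibredChart.mkMom_momCoord (c : FibredChart n m π) {y : Y} (hy : y ∈ c.tot.source)
    (P : (Eu n →L[ℝ] Vert n m π y) →L[ℝ] TopForm n) : c.mkMom y (c.momCoord y P) = P := by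
  obtain ⟨e, he, -⟩ := c.exists_vertCoord_equiv hy
  have h3 := fun v => DFunLike.congr_fun (c.base_symm_dAt (c.proj_mem _ hy)) v
  simp only [ContinuousLinearMap.comp_apply, ContinuousLinearMap.id_apply] at h3
  have hx := c.proj_mem _ hy
  ext1 Φ
  have hΦ : (e.symm : Eu m →L[ℝ] Vert n m π y).comp ((((e : Vert n m π y →L[ℝ] Eu m)).comp
      (Φ.comp (dAt (Eu n) (Eu n) c.base.symm (c.base (π y))))).comp
        (dAt (Eu n) (Eu n) c.base (π y))) = Φ := by
    ext1 v
    simp [h3]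
  have hf : ∀ η : TopForm n, η (fun i => dAt (Eu n) (Eu n) c.base.symm (c.base (π y)) (stdVec n i)) •
      (stdVol n).compContinuousLinearMap (dAt (Eu n) (Eu n) c.base (π y)) = η := by
    intro η
    have := TopForm.eq_smul
      (η.compContinuousLinearMap (dAt (Eu n) (Eu n) c.base.symm (c.base (π y))))
    ext v
    have := congrArg (fun f : TopForm n => f fun i => dAt (Eu n) (Eu n) c.base (π y) (v i)) this
    simp [comp_def, h3] at this
    simp [comp_def, ← this]
  simp only [mkMom, momCoord, ← he, ContinuousLinearMap.inverse_equiv,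
    ContinuousLinearMap.smulRight_apply, ContinuousLinearMap.comp_apply, sandwich_apply, hΦ]
  exact hf _

theorem FibredChart.momCoord_mkMom (c c' : FibredChart n m π) {y : Y} (hy' : y ∈ c'.tot.source)
    (p : (Eu n →L[ℝ] Eu m) →L[ℝ] ℝ) :
    c'.momCoord y (c.mkMom y p) =
      stdVol n (fun i => dAt (Eu n) (Eu n) c.base (π y)
        (dAt (Eu n) (Eu n) c'.base.symm (c'.base (π y)) (stdVec n i))) •
      p.comp (sandwich ((ContinuousLinearMap.snd ℝ (Eu n) (Eu m)).comp
        (((dAt (Eu n × Eu m) (Eu n × Eu m) c.tot y).comp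
        (dAt (Eu n × Eu m) (Eu n × Eu m) c'.tot.symm (c'.tot y))).comp
          (ContinuousLinearMap.inr ℝ (Eu n) (Eu m))))
        ((dAt (Eu n) (Eu n) c'.base (π y)).comp
          (dAt (Eu n) (Eu n) c.base.symm (c.base (π y))))) := by
  obtain ⟨e, he, he2⟩ := c'.exists_vertCoord_equiv hy'
  ext1 β
  simp only [mkMom, momCoord, ← he, ContinuousLinearMap.inverse_equiv,
    ContinuousLinearMap.smulRight_apply, ContinuousLinearMap.comp_apply, sandwich_apply,
    evalTop, smul_apply, smul_eq_mul]
  simp only [ContinuousAlternatingMap.apply_apply, ContinuousAlternatingMap.smul_apply, smul_eq_mul,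
    ContinuousAlternatingMap.compContinuousLinearMap_apply, comp_def]
  rw [mul_comm]
  refine congrArg₂ (· * ·) rfl (congrArg p ?_)
  ext1 v
  simp [vertCoord, he2]

theorem FibredChart.momCoord_mkMom_self (c : FibredChart n m π) {y : Y} (hy : y ∈ c.tot.source)
    (p : (Eu n →L[ℝ] Eu m) →L[ℝ] ℝ) : c.momCoord y (c.mkMom y p) = p := by
  rw [c.momCoord_mkMom c hy, stdVol_dAt_base c (c.proj_mem _ hy), c.tot_dAt_symm hy,
    c.base_dAt_symm (c.proj_mem _ hy)]
  ext1 β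
  simp only [one_smul, ContinuousLinearMap.comp_apply, sandwich_apply]
  congr 1

section charts
variable [IsManifold 𝓘(ℝ, Eu n) ∞ X] [hπ : IsSmoothFibreBundle (Eu n) m π]

variable (n m π) in
/-- A chosen fibred chart around a point. -/
def fibredChartAt (y : Y) : FibredChart n m π := (exists_fibredChart π y).choose

theorem mem_fibredChartAt (y : Y) : y ∈ (fibredChartAt n m π y).tot.source :=
  (exists_fibredChart π y).choose_spec

/-- The adapted chart `(x^λ, y^i, y^i_λ)` of `J¹Y`. -/
def FibredChart.jetChart (c : FibredChart n m π) :
    PartialEquiv (Jet n m π) ((Eu n × Eu m) × (Eu n →L[ℝ] Eu m)) where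
  toFun := c.jetCoord
  invFun p := by
    classical
    exact if h : c.tot.symm p.1 ∈ c.tot.source then c.mkJet _ h p.2
      else (fibredChartAt n m π (c.tot.symm p.1)).mkJet _ (mem_fibredChartAt _) 0
  source := {z | z.pt ∈ c.tot.source}
  target := {p | p.1 ∈ c.tot.target}
  map_source' z hz := c.tot.map_source hz
  map_target' p hp := by
    rw [dif_pos (c.tot.map_target hp)]
    exact c.tot.map_target hp
  left_inv' z hz := by
    have h : c.tot.symm (c.jetCoord z).1 = z.pt := c.tot.left_inv hz
    have hz' : z.pt ∈ c.tot.source := hz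
    simp only [h, hz', dif_pos]
    exact c.mkJet_jetCoord z hz
  right_inv' p hp := by
    rw [dif_pos (c.tot.map_target hp), c.jetCoord_mkJet]
    rw [c.tot.right_inv hp]

theorem FibredChart.jetChart_symm_apply (c : FibredChart n m π)
    {p : (Eu n × Eu m) × (Eu n →L[ℝ] Eu m)} (hp : p.1 ∈ c.tot.target) :
    c.jetChart.symm p = c.mkJet _ (c.tot.map_target hp) p.2 :=
  dif_pos (c.tot.map_target hp)

theorem FibredChart.jet_transition (c c' : FibredChart n m π) :
    IsOpen (c.jetChart.symm.trans c'.jetChart).source ∧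
    ContDiffOn ℝ ∞ (c.jetChart.symm.trans c'.jetChart)
      (c.jetChart.symm.trans c'.jetChart).source := by
  have hs : (c.jetChart.symm.trans c'.jetChart).source =
      Prod.fst ⁻¹' (c.tot.symm.trans c'.tot).source := by
    ext p
    simp only [PartialEquiv.trans_source, PartialEquiv.symm_source, mem_inter_iff, mem_preimage,
      OpenPartialHomeomorph.trans_source, OpenPartialHomeomorph.symm_source]
    refine and_congr_right fun hp => ?_
    rw [c.jetChart_symm_apply hp]; rfl
  have ho : IsOpen (c.jetChart.symm.trans c'.jetChart).source := by
    rw [hs]; exact (c.tot.symm.trans c'.tot).open_source.preimage continuous_fst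
  refine ⟨ho, ?_⟩
  rw [hs]
  have hT : ContDiffOn ℝ ∞ (c'.tot ∘ c.tot.symm) (c.tot.symm.trans c'.tot).source :=
    contDiffOn_transition _ _ c.tot_symm_smooth c'.tot_smooth
  have hB : ContDiffOn ℝ ∞ (c.base ∘ c'.base.symm) (c'.base.symm.trans c.base).source :=
    contDiffOn_transition _ _ c'.base_symm_smooth c.base_smooth
  have hT' := hT.fderiv_of_isOpen (m := ∞) (c.tot.symm.trans c'.tot).open_source (by simp)
  have hB' := hB.fderiv_of_isOpen (m := ∞) (c'.base.symm.trans c.base).open_source (by simp)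
  set S : Set ((Eu n × Eu m) × (Eu n →L[ℝ] Eu m)) :=
    Prod.fst ⁻¹' (c.tot.symm.trans c'.tot).source with hS
  have h1 : ContDiffOn ℝ ∞ (fun p : (Eu n × Eu m) × (Eu n →L[ℝ] Eu m) =>
      (c'.tot ∘ c.tot.symm) p.1) S := hT.comp contDiff_fst.contDiffOn fun p hp => hp
  have h2 : ContDiffOn ℝ ∞ (fun p : (Eu n × Eu m) × (Eu n →L[ℝ] Eu m) =>
      fderiv ℝ (c'.tot ∘ c.tot.symm) p.1) S := hT'.comp contDiff_fst.contDiffOn fun p hp => hp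
  have h3 : ContDiffOn ℝ ∞ (fun p : (Eu n × Eu m) × (Eu n →L[ℝ] Eu m) =>
      fderiv ℝ (c.base ∘ c'.base.symm) ((c'.tot ∘ c.tot.symm) p.1).1) S := by
    refine hB'.comp h1.fst fun p hp => ?_
    have hp' : c.tot.symm p.1 ∈ c'.tot.source := hp.2
    have hp'' : c.tot.symm p.1 ∈ c.tot.source := c.tot.map_target hp.1
    rw [OpenPartialHomeomorph.trans_source]
    simp only [comp_apply, mem_inter_iff, OpenPartialHomeomorph.symm_source, mem_preimage]
    rw [c'.fst_tot _ hp']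
    refine ⟨c'.base.map_source (c'.proj_mem _ hp'), ?_⟩
    rw [c'.base.left_inv (c'.proj_mem _ hp')]
    exact c.proj_mem _ hp''
  have h4 : ContDiffOn ℝ ∞ (fun p : (Eu n × Eu m) × (Eu n →L[ℝ] Eu m) =>
      ((c'.tot ∘ c.tot.symm) p.1, (ContinuousLinearMap.snd ℝ (Eu n) (Eu m)).comp
        ((fderiv ℝ (c'.tot ∘ c.tot.symm) p.1).comp
          (((ContinuousLinearMap.id ℝ (Eu n)).prod p.2).comp
            (fderiv ℝ (c.base ∘ c'.base.symm) ((c'.tot ∘ c.tot.symm) p.1).1))))) S := by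
    refine h1.prodMk (contDiffOn_const.clm_comp (h2.clm_comp (ContDiffOn.clm_comp ?_ h3)))
    have : ContDiff ℝ ∞ fun p : (Eu n × Eu m) × (Eu n →L[ℝ] Eu m) =>
        (ContinuousLinearMap.inl ℝ (Eu n) (Eu m)) + 
          (ContinuousLinearMap.inr ℝ (Eu n) (Eu m)).comp p.2 :=
      contDiff_const.add (contDiff_const.clm_comp contDiff_snd)
    refine this.contDiffOn.congr fun p _ => ?_
    ext v <;> simp
  refine h4.congr fun p hp => ?_
  have hp' : c.tot.symm p.1 ∈ c'.tot.source := hp.2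
  have hp'' : c.tot.symm p.1 ∈ c.tot.source := c.tot.map_target hp.1
  rw [PartialEquiv.coe_trans, comp_apply, c.jetChart_symm_apply hp.1]
  rw [fderiv_transition _ _ c.tot_symm_smooth c'.tot_smooth hp.1 hp']
  have e1 : ((c'.tot ∘ c.tot.symm) p.1).1 = c'.base (π (c.tot.symm p.1)) := c'.fst_tot _ hp'
  rw [e1]
  have e2 := c'.base.left_inv (c'.proj_mem _ hp')
  rw [fderiv_transition _ _ c'.base_symm_smooth c.base_smooth
    (c'.base.map_source (c'.proj_mem _ hp')) (by rw [e2]; exact c.proj_mem _ hp''), e2]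
  have e3 := c.tot.right_inv hp.1
  change c'.jetCoord _ = _
  simp only [jetCoord, mkJet, e3]
  rfl

variable (n m π) in
/-- The atlas of adapted charts of `J¹Y`. -/
def jetCore : ChartedSpaceCore ((Eu n × Eu m) × (Eu n →L[ℝ] Eu m)) (Jet n m π) where
  atlas := range fun c : FibredChart n m π => c.jetChart
  chartAt z := (fibredChartAt n m π z.pt).jetChart
  mem_chart_source z := mem_fibredChartAt z.pt
  chart_mem_atlas z := mem_range_self _
  open_source := by
    rintro _ _ ⟨c, rfl⟩ ⟨c', rfl⟩
    exact (c.jet_transition c').1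
  continuousOn_toFun := by
    rintro _ _ ⟨c, rfl⟩ ⟨c', rfl⟩
    exact (c.jet_transition c').2.continuousOn

/-- The manifold topology of `J¹Y`. -/
instance : TopologicalSpace (Jet n m π) := (jetCore n m π).toTopologicalSpace

instance : ChartedSpace ((Eu n × Eu m) × (Eu n →L[ℝ] Eu m)) (Jet n m π) :=
  (jetCore n m π).toChartedSpace

theorem isManifold_of_core {V : Type*} [NormedAddCommGroup V] [NormedSpace ℝ V] {M : Type*}
    (C : ChartedSpaceCore V M)
    (h : ∀ e ∈ C.atlas, ∀ e' ∈ C.atlas,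
      ContDiffOn ℝ ∞ (e.symm.trans e') (e.symm.trans e').source) :
    @IsManifold ℝ _ V _ _ V _ 𝓘(ℝ, V) ∞ M C.toTopologicalSpace C.toChartedSpace := by
  let _ := C.toTopologicalSpace
  let _ := C.toChartedSpace
  refine isManifold_of_contDiffOn 𝓘(ℝ, V) ∞ M ?_
  intro e e' he he'
  have he : e ∈ ⋃ (e : PartialEquiv M V) (he : e ∈ C.atlas), {C.openPartialHomeomorph e he} := he
  have he' : e' ∈ ⋃ (e : PartialEquiv M V) (he : e ∈ C.atlas), {C.openPartialHomeomorph e he} := he'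
  simp only [mem_iUnion, mem_singleton_iff] at he he'
  obtain ⟨e, h1, rfl⟩ := he
  obtain ⟨e', h1', rfl⟩ := he'
  simp only [modelWithCornersSelf_coe, modelWithCornersSelf_coe_symm, range_id, inter_univ,
    id_comp, comp_id, preimage_id]
  exact h e h1 e' h1'

instance : IsManifold 𝓘(ℝ, (Eu n × Eu m) × (Eu n →L[ℝ] Eu m)) ∞ (Jet n m π) := by
  apply isManifold_of_core
  rintro _ ⟨c, rfl⟩ _ ⟨c', rfl⟩
  exact (c.jet_transition c').2

/-- The holonomic chart `(x^λ, y^i, p^λ_i)` of the Legendre bundle. -/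
def FibredChart.legendreChart (c : FibredChart n m π) :
    PartialEquiv (LegendrePoint n m π) ((Eu n × Eu m) × ((Eu n →L[ℝ] Eu m) →L[ℝ] ℝ)) where
  toFun q := (c.tot q.pt, c.momCoord q.pt q.mom)
  invFun p := ⟨c.tot.symm p.1, c.mkMom _ p.2⟩
  source := {q | q.pt ∈ c.tot.source}
  target := {p | p.1 ∈ c.tot.target}
  map_source' z hz := c.tot.map_source hz
  map_target' p hp := c.tot.map_target hp
  left_inv' q hq := by
    have h : c.tot.symm (c.tot q.pt) = q.pt := c.tot.left_inv hq
    change (⟨c.tot.symm (c.tot q.pt), c.mkMom _ (c.momCoord q.pt q.mom)⟩ :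
      LegendrePoint n m π) = q
    rw [h, c.mkMom_momCoord hq]
  right_inv' p hp := by
    simp only [c.momCoord_mkMom_self (c.tot.map_target hp), c.tot.right_inv hp]

theorem FibredChart.legendre_transition (c c' : FibredChart n m π) :
    IsOpen (c.legendreChart.symm.trans c'.legendreChart).source ∧
    ContDiffOn ℝ ∞ (c.legendreChart.symm.trans c'.legendreChart)
      (c.legendreChart.symm.trans c'.legendreChart).source := by
  have hs : (c.legendreChart.symm.trans c'.legendreChart).source =
      Prod.fst ⁻¹' (c.tot.symm.trans c'.tot).source := rfl
  have ho : IsOpen (c.legendreChart.symm.trans c'.legendreChart).source := by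
    rw [hs]; exact (c.tot.symm.trans c'.tot).open_source.preimage continuous_fst
  refine ⟨ho, ?_⟩
  rw [hs]
  have hT : ContDiffOn ℝ ∞ (c'.tot ∘ c.tot.symm) (c.tot.symm.trans c'.tot).source :=
    contDiffOn_transition _ _ c.tot_symm_smooth c'.tot_smooth
  have hR : ContDiffOn ℝ ∞ (c.tot ∘ c'.tot.symm) (c'.tot.symm.trans c.tot).source :=
    contDiffOn_transition _ _ c'.tot_symm_smooth c.tot_smooth
  have hB : ContDiffOn ℝ ∞ (c.base ∘ c'.base.symm) (c'.base.symm.trans c.base).source :=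
    contDiffOn_transition _ _ c'.base_symm_smooth c.base_smooth
  have hC : ContDiffOn ℝ ∞ (c'.base ∘ c.base.symm) (c.base.symm.trans c'.base).source :=
    contDiffOn_transition _ _ c.base_symm_smooth c'.base_smooth
  have hR' := hR.fderiv_of_isOpen (m := ∞) (c'.tot.symm.trans c.tot).open_source (by simp)
  have hB' := hB.fderiv_of_isOpen (m := ∞) (c'.base.symm.trans c.base).open_source (by simp)
  have hC' := hC.fderiv_of_isOpen (m := ∞) (c.base.symm.trans c'.base).open_source (by simp)
  set S : Set ((Eu n × Eu m) × ((Eu n →L[ℝ] Eu m) →L[ℝ] ℝ)) :=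
    Prod.fst ⁻¹' (c.tot.symm.trans c'.tot).source with hS
  have h1 : ContDiffOn ℝ ∞ (fun p : (Eu n × Eu m) × ((Eu n →L[ℝ] Eu m) →L[ℝ] ℝ) =>
      (c'.tot ∘ c.tot.symm) p.1) S := hT.comp contDiff_fst.contDiffOn fun p hp => hp
  have m1 : ∀ p ∈ S, c.tot.symm p.1 ∈ c'.tot.source := fun p hp => hp.2
  have m2 : ∀ p ∈ S, c.tot.symm p.1 ∈ c.tot.source := fun p hp => c.tot.map_target hp.1
  have e1 : ∀ p ∈ S, ((c'.tot ∘ c.tot.symm) p.1).1 = c'.base (π (c.tot.symm p.1)) :=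
    fun p hp => c'.fst_tot _ (m1 p hp)
  have e2 : ∀ p ∈ S, p.1.1 = c.base (π (c.tot.symm p.1)) := fun p hp => by
    rw [← c.fst_tot _ (m2 p hp), c.tot.right_inv hp.1]
  have h2 : ContDiffOn ℝ ∞ (fun p : (Eu n × Eu m) × ((Eu n →L[ℝ] Eu m) →L[ℝ] ℝ) =>
      fderiv ℝ (c.tot ∘ c'.tot.symm) ((c'.tot ∘ c.tot.symm) p.1)) S := by
    refine hR'.comp h1 fun p hp => ?_
    rw [OpenPartialHomeomorph.trans_source]
    refine ⟨c'.tot.map_source (m1 p hp), ?_⟩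
    simp only [comp_apply, mem_preimage]
    rw [c'.tot.left_inv (m1 p hp)]; exact m2 p hp
  have h3 : ContDiffOn ℝ ∞ (fun p : (Eu n × Eu m) × ((Eu n →L[ℝ] Eu m) →L[ℝ] ℝ) =>
      fderiv ℝ (c.base ∘ c'.base.symm) ((c'.tot ∘ c.tot.symm) p.1).1) S := by
    refine hB'.comp h1.fst fun p hp => ?_
    rw [OpenPartialHomeomorph.trans_source, e1 p hp]
    refine ⟨c'.base.map_source (c'.proj_mem _ (m1 p hp)), ?_⟩
    rw [mem_preimage, c'.base.left_inv (c'.proj_mem _ (m1 p hp))]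
    exact c.proj_mem _ (m2 p hp)
  have h4 : ContDiffOn ℝ ∞ (fun p : (Eu n × Eu m) × ((Eu n →L[ℝ] Eu m) →L[ℝ] ℝ) =>
      fderiv ℝ (c'.base ∘ c.base.symm) p.1.1) S := by
    refine hC'.comp contDiff_fst.fst.contDiffOn fun p hp => ?_
    rw [OpenPartialHomeomorph.trans_source, e2 p hp]
    refine ⟨c.base.map_source (c.proj_mem _ (m2 p hp)), ?_⟩
    rw [mem_preimage, c.base.left_inv (c.proj_mem _ (m2 p hp))]
    exact c'.proj_mem _ (m1 p hp)
  have h5 : ContDiffOn ℝ ∞ (fun p : (Eu n × Eu m) × ((Eu n →L[ℝ] Eu m) →L[ℝ] ℝ) =>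
      stdVol n (fun i => fderiv ℝ (c.base ∘ c'.base.symm) ((c'.tot ∘ c.tot.symm) p.1).1
        (stdVec n i))) S := by
    refine (stdVol n).toContinuousMultilinearMap.contDiff.comp_contDiffOn ?_
    exact contDiffOn_pi.2 fun i => h3.clm_apply contDiffOn_const
  have h6 : ContDiffOn ℝ ∞ (fun p : (Eu n × Eu m) × ((Eu n →L[ℝ] Eu m) →L[ℝ] ℝ) =>
      sandwich ((ContinuousLinearMap.snd ℝ (Eu n) (Eu m)).comp
        ((fderiv ℝ (c.tot ∘ c'.tot.symm) ((c'.tot ∘ c.tot.symm) p.1)).comp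
          (ContinuousLinearMap.inr ℝ (Eu n) (Eu m))))
        (fderiv ℝ (c'.base ∘ c.base.symm) p.1.1)) S := by
    refine ContDiffOn.clm_comp ?_ ?_
    · exact (ContinuousLinearMap.contDiff _).comp_contDiffOn
        (contDiffOn_const.clm_comp (h2.clm_comp contDiffOn_const))
    · exact (ContinuousLinearMap.contDiff _).comp_contDiffOn h4
  refine (h1.prodMk (h5.smul (contDiff_snd.contDiffOn.clm_comp h6))).congr fun p hp => ?_
  have hp' := m1 p hp
  have hp'' := m2 p hp
  rw [PartialEquiv.coe_trans, comp_apply]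
  change (c'.tot (c.tot.symm p.1), c'.momCoord (c.tot.symm p.1) (c.mkMom (c.tot.symm p.1) p.2)) =
    ((c'.tot ∘ c.tot.symm) p.1, (_ : ℝ) • (_ : (Eu n →L[ℝ] Eu m) →L[ℝ] ℝ))
  rw [c.momCoord_mkMom c' hp']
  have e2' := c'.base.left_inv (c'.proj_mem _ hp')
  have e3' := c.base.left_inv (c.proj_mem _ hp'')
  have e4' := c'.tot.left_inv hp'
  beta_reduce
  rw [e1 p hp, fderiv_transition _ _ c'.base_symm_smooth c.base_smooth
    (c'.base.map_source (c'.proj_mem _ hp')) (by rw [e2']; exact c.proj_mem _ hp''), e2']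
  rw [e2 p hp, fderiv_transition _ _ c.base_symm_smooth c'.base_smooth
    (c.base.map_source (c.proj_mem _ hp'')) (by rw [e3']; exact c'.proj_mem _ hp'), e3']
  simp only [comp_apply]
  rw [fderiv_transition _ _ c'.tot_symm_smooth c.tot_smooth (c'.tot.map_source hp')
    (by rw [e4']; exact hp''), e4']
  rfl

variable (n m π) in
/-- The atlas of holonomic charts of the Legendre bundle. -/
def legendreCore :
    ChartedSpaceCore ((Eu n × Eu m) × ((Eu n →L[ℝ] Eu m) →L[ℝ] ℝ)) (LegendrePoint n m π) where
  atlas := range fun c : FibredChart n m π => c.legendreChart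
  chartAt z := (fibredChartAt n m π z.pt).legendreChart
  mem_chart_source z := mem_fibredChartAt z.pt
  chart_mem_atlas z := mem_range_self _
  open_source := by
    rintro _ _ ⟨c, rfl⟩ ⟨c', rfl⟩
    exact (c.legendre_transition c').1
  continuousOn_toFun := by
    rintro _ _ ⟨c, rfl⟩ ⟨c', rfl⟩
    exact (c.legendre_transition c').2.continuousOn

/-- The manifold topology of the Legendre bundle. -/
instance : TopologicalSpace (LegendrePoint n m π) := (legendreCore n m π).toTopologicalSpace

instance : ChartedSpace ((Eu n × Eu m) × ((Eu n →L[ℝ] Eu m) →L[ℝ] ℝ)) (LegendrePoint n m π) :=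
  (legendreCore n m π).toChartedSpace

instance : IsManifold 𝓘(ℝ, (Eu n × Eu m) × ((Eu n →L[ℝ] Eu m) →L[ℝ] ℝ)) ∞
    (LegendrePoint n m π) := by
  apply isManifold_of_core
  rintro _ ⟨c, rfl⟩ _ ⟨c', rfl⟩
  exact (c.legendre_transition c').2

end charts

/-- The `n`-form `(v₁, …, vₙ) ↦ ∑ⱼ η(vⱼ)(p v₁, …, a, …, p vₙ)` (with `a` in the `j`-th slot). If
`η(v) = α(v) ω` for a `1`-form `α` and an `n`-form `ω`, it is the exterior product
`α ∧ p^*(a ⌋ ω)`. -/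
def slotForm {V U : Type*} [NormedAddCommGroup V] [NormedSpace ℝ V] [NormedAddCommGroup U]
    [NormedSpace ℝ U] (η : V →L[ℝ] (U [⋀^Fin n]→L[ℝ] ℝ)) (p : V →L[ℝ] U) (a : U) :
    V [⋀^Fin n]→L[ℝ] ℝ where
  toFun v := ∑ j, η (v j) (update (fun i => p (v i)) j a)
  map_update_add' := by
    intro inst v i x y
    obtain rfl : inst = instDecidableEqFin n := Subsingleton.elim _ _
    have key : ∀ z : V, (fun l => p (update v i z l)) = update (fun l => p (v l)) i (p z) := by
      intro z; ext1 l; by_cases h : l = i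
      · subst h; simp
      · simp [h]
    rw [← Finset.sum_add_distrib]
    refine Finset.sum_congr rfl fun j _ => ?_
    simp only [key]
    by_cases h : j = i
    · subst h; simp
    · simp only [update_of_ne h, update_comm (Ne.symm h), ContinuousAlternatingMap.map_update_add, map_add]
  map_update_smul' := by
    intro inst v i c x
    obtain rfl : inst = instDecidableEqFin n := Subsingleton.elim _ _
    have key : ∀ z : V, (fun l => p (update v i z l)) = update (fun l => p (v l)) i (p z) := by
      intro z; ext1 l; by_cases h : l = i
      · subst h; simp
      · simp [h]
    rw [Finset.smul_sum]
    refine Finset.sum_congr rfl fun j _ => ?_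
    simp only [key]
    by_cases h : j = i
    · subst h; simp
    · simp only [update_of_ne h, update_comm (Ne.symm h), ContinuousAlternatingMap.map_update_smul,
        map_smul]
  map_eq_zero_of_eq' := by
    intro v i j hv hij
    have h0 : ∀ l, l ≠ i → l ≠ j → η (v l) (update (fun i => p (v i)) l a) = 0 := by
      intro l hi hj
      refine (η (v l)).map_eq_zero_of_eq _ (i := i) (j := j) ?_ hij
      rw [update_of_ne (Ne.symm hi), update_of_ne (Ne.symm hj), hv]
    have hsw : update (fun i => p (v i)) j a = (update (fun i => p (v i)) i a) ∘ Equiv.swap i j := by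
      ext1 l
      by_cases h1 : l = i
      · subst h1; simp [hij, hij.symm, hv]
      · by_cases h2 : l = j
        · subst h2; simp
        · simp [Equiv.swap_apply_of_ne_of_ne h1 h2, h1, h2]
    change ∑ l, η (v l) (update (fun i => p (v i)) l a) = 0
    rw [← Finset.sum_subset (Finset.subset_univ {i, j})
      (fun l _ hl => by
        simp only [Finset.mem_insert, Finset.mem_singleton, not_or] at hl
        exact h0 l hl.1 hl.2), Finset.sum_pair hij, hsw, hv]
    exact (congrArg _ ((η (v j)).toAlternatingMap.map_swap _ hij)).trans (add_neg_cancel _)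
  cont := by
    refine continuous_finsetSum _ fun j _ => ?_
    have h1 : Continuous fun v : Fin n → V => η (v j) := η.continuous.comp (continuous_apply j)
    have h2 : Continuous fun v : Fin n → V => update (fun i => p (v i)) j a :=
      (continuous_pi fun i => p.continuous.comp (continuous_apply i)).update j continuous_const
    exact h1.eval h2

section forms

variable {E : Type*} [NormedAddCommGroup E] [NormedSpace ℝ E] {M : Type*} [TopologicalSpace M]
  [ChartedSpace E M] {F : Type*} [NormedAddCommGroup F] [NormedSpace ℝ F] {N : Type*}
  [TopologicalSpace N] [ChartedSpace F N]

/-- The exterior differential of a form on a manifold. At `x` it is computed in the preferred chart at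
`x`, through which Mathlib identifies `T_xM` with the model space. -/
def extDerivAt {k : ℕ} (H : M → E [⋀^Fin k]→L[ℝ] ℝ) (x : M) : E [⋀^Fin (k + 1)]→L[ℝ] ℝ :=
  extDeriv (fun q => (H ((chartAt E x).symm q)).compContinuousLinearMap
    (dAt E E (chartAt E x).symm q)) (chartAt E x x)

/-- The pull-back `f^*H` of a form. -/
def pullback {k : ℕ} (f : M → N) (H : N → F [⋀^Fin k]→L[ℝ] ℝ) (x : M) : E [⋀^Fin k]→L[ℝ] ℝ :=
  (H (f x)).compContinuousLinearMap (dAt E F f x)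

variable (n E) in
/-- `s` is a (global, smooth) section of `p : M → X`. -/
structure IsSmoothSection (p : M → X) (s : X → M) : Prop where
  contMDiff : ContMDiff 𝓘(ℝ, Eu n) 𝓘(ℝ, E) ∞ s
  proj_apply : ∀ x, p (s x) = x

variable (n) in
/-- `u` is a smooth vector field on `M` that is vertical with respect to `p : M → X`. -/
structure IsVerticalField [IsManifold 𝓘(ℝ, E) ∞ M] (p : M → X)
    (u : ∀ z : M, TangentSpace 𝓘(ℝ, E) z) : Prop where
  contMDiff : ContMDiff 𝓘(ℝ, E) 𝓘(ℝ, E).tangent ∞ fun z => (⟨z, u z⟩ : TangentBundle 𝓘(ℝ, E) M)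
  vertical : ∀ z, mfderiv 𝓘(ℝ, E) 𝓘(ℝ, Eu n) p z (u z) = 0

/-- `s` is a section of `p : M → X` with `s^*(u ⌋ dH) = 0` for every vertical vector field `u` on
`M → X`. -/
structure IsSolution [IsManifold 𝓘(ℝ, E) ∞ M] (p : M → X) (H : M → E [⋀^Fin n]→L[ℝ] ℝ)
    (s : X → M) : Prop where
  isSection : IsSmoothSection n E p s
  equation : ∀ u : ∀ z : M, TangentSpace 𝓘(ℝ, E) z, IsVerticalField n p u →
    ∀ x : X, ((extDerivAt H (s x)).curryLeft (u (s x))).compContinuousLinearMap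
      (dAt (Eu n) E s x) = 0

end forms

section lagrangian
variable [IsManifold 𝓘(ℝ, Eu n) ∞ X] [IsSmoothFibreBundle (Eu n) m π]

variable (n m) in
/-- The model space of `J¹Y`. -/
abbrev JetModel := (Eu n × Eu m) × (Eu n →L[ℝ] Eu m)

variable (n m) in
/-- The model space of the Legendre bundle. -/
abbrev LegendreModel := (Eu n × Eu m) × ((Eu n →L[ℝ] Eu m) →L[ℝ] ℝ)

variable (n m π) in
/-- A first order Lagrangian: a smooth bundle map `L : J¹Y → ⋀ⁿT*X` over `X`. Smoothness is that of the
coefficient `ℒ = L(∂₁, …, ∂ₙ)` in `L = ℒ dx¹ ∧ ⋯ ∧ dxⁿ` for every chart of `X`. -/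
structure Lagrangian where
  toFun : Jet n m π → TopForm n
  smooth : ∀ ψ ∈ IsManifold.maximalAtlas 𝓘(ℝ, Eu n) ∞ X,
    ContMDiffOn 𝓘(ℝ, JetModel n m) 𝓘(ℝ, ℝ) ∞
      (fun z : Jet n m π => toFun z fun i => dAt (Eu n) (Eu n) ψ.symm (ψ (π z.pt)) (stdVec n i))
      {z | π z.pt ∈ ψ.source}

/-- The affine structure of `J¹Y → Y`: translation of a jet at `y` by an element of
`T*X ⊗ V_yY = Hom (T_{π y}X, V_yY)`. -/
def Jet.translate (z : Jet n m π) (φ : Eu n →L[ℝ] Vert n m π z.pt) : Jet n m π where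
  pt := z.pt
  lin := z.lin + (Vert n m π z.pt).subtypeL.comp φ
  proj_lin := by
    have : (dAt (Eu n × Eu m) (Eu n) π z.pt).comp ((Vert n m π z.pt).subtypeL.comp φ) = 0 := by
      ext1 w; exact (φ w).2
    rw [ContinuousLinearMap.comp_add, this, add_zero, z.proj_lin]

/-- The Legendre map `J¹Y → Π`, the derivative of `L` along the fibres of `J¹Y → Y`; in coordinates
`p^λ_i = ∂ℒ/∂y^i_λ`. -/
def legendreMap (L : Lagrangian n m π) (z : Jet n m π) : LegendrePoint n m π :=
  ⟨z.pt, fderiv ℝ (fun φ : Eu n →L[ℝ] Vert n m π z.pt => L.toFun (z.translate φ)) 0⟩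

/-- The contact form `θ^i ⊗ ∂_i = (dy^i - y^i_λ dx^λ) ⊗ ∂_i` on `J¹Y`, with values in `VY`. -/
def contactForm (z : Jet n m π) : JetModel n m →L[ℝ] Vert n m π z.pt :=
  (dAt (JetModel n m) (Eu n × Eu m) (Jet.pt : Jet n m π → Y) z -
    z.lin.comp ((dAt (Eu n × Eu m) (Eu n) π z.pt).comp
      (dAt (JetModel n m) (Eu n × Eu m) (Jet.pt : Jet n m π → Y) z))).codRestrict _ (by
    intro v
    rw [LinearMap.mem_ker]
    have h := fun w => DFunLike.congr_fun z.proj_lin w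
    simp only [ContinuousLinearMap.comp_apply, ContinuousLinearMap.id_apply] at h
    simp [h])

/-- The Poincaré–Cartan form `H_L = L + π^λ_i θ^i ∧ ω_λ` on `J¹Y`, where `π^λ_i = ∂ℒ/∂y^i_λ` and
`ω_λ = ∂_λ ⌋ ω`. The `λ`-th summand comes from the form-valued `1`-form
`v ↦ π^λ_i θ^i(v) ω`, which is the Legendre map evaluated at `dx^λ ⊗ θ(v)`; the base
vectors `∂_λ` are those of the preferred chart at the point of `X`. -/
def poincareCartan (L : Lagrangian n m π) (z : Jet n m π) : JetModel n m [⋀^Fin n]→L[ℝ] ℝ :=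
  (L.toFun z).compContinuousLinearMap ((dAt (Eu n × Eu m) (Eu n) π z.pt).comp
      (dAt (JetModel n m) (Eu n × Eu m) (Jet.pt : Jet n m π → Y) z)) +
  ∑ l : Fin n, slotForm
    ((legendreMap L z).mom.comp
      ((ContinuousLinearMap.smulRightL ℝ (Eu n) (Vert n m π z.pt) (EuclideanSpace.proj l)).comp
        (contactForm z)))
    ((dAt (Eu n × Eu m) (Eu n) π z.pt).comp
      (dAt (JetModel n m) (Eu n × Eu m) (Jet.pt : Jet n m π → Y) z))
    (stdVec n l)

/-- The Lagrangian constraint space `N_L ⊂ Π`, the image of the Legendre map. -/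
abbrev ConstraintSpace (L : Lagrangian n m π) := ↥(range (legendreMap L))

/-- The Legendre map as a map `J¹Y → N_L`. -/
def constraintMap (L : Lagrangian n m π) : Jet n m π → ConstraintSpace L :=
  rangeFactorization (legendreMap L)

variable (k : ℕ)

/-- `L` is almost regular: `N_L` is a closed imbedded subbundle of `Π → Y`, and the (surjective) map
`J¹Y → N_L` is a submersion with connected fibres. The manifold structure of `N_L` is the one
for which the inclusion into `Π` is an imbedding; `k` is the dimension of the fibres of `N_L → Y`. -/
structure IsAlmostRegular (L : Lagrangian n m π)
    [ChartedSpace ((Eu n × Eu m) × Eu k) (ConstraintSpace L)] : Prop where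
  isClosed : IsClosed (range (legendreMap L))
  isSmoothEmbedding : Manifold.IsSmoothEmbedding 𝓘(ℝ, (Eu n × Eu m) × Eu k)
    𝓘(ℝ, LegendreModel n m) ∞ (Subtype.val : ConstraintSpace L → LegendrePoint n m π)
  isSmoothFibreBundle : IsSmoothFibreBundle (Eu n × Eu m) k
    fun q : ConstraintSpace L => q.1.pt
  isSubmersion : Manifold.IsSubmersion 𝓘(ℝ, JetModel n m) 𝓘(ℝ, (Eu n × Eu m) × Eu k) ∞
    (constraintMap L)
  isConnected_fibre : ∀ q : ConstraintSpace L, IsConnected (constraintMap L ⁻¹' {q})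

/-- The Cartan equations for `s : X → J¹Y`: `s^*(u ⌋ dH_L) = 0` for all vertical vector fields `u` on
`J¹Y → X`. -/
def SolvesCartan (L : Lagrangian n m π) (s : X → Jet n m π) : Prop :=
  IsSolution (fun z : Jet n m π => π z.pt) (poincareCartan L) s

/-- The constrained Hamilton equations for `r : X → N_L`: `r^*(u ⌋ dH_N) = 0` for all vertical vector
fields `u` on `N_L → X`, where `H_N = Ψ^*H_L` for a section `Ψ` of `J¹Y → N_L`. -/
def SolvesConstrainedHamilton (L : Lagrangian n m π)
    [ChartedSpace ((Eu n × Eu m) × Eu k) (ConstraintSpace L)]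
    [IsManifold 𝓘(ℝ, (Eu n × Eu m) × Eu k) ∞ (ConstraintSpace L)]
    (Ψ : ConstraintSpace L → Jet n m π) (r : X → ConstraintSpace L) : Prop :=
  IsSolution (fun q : ConstraintSpace L => π q.1.pt)
    (pullback (E := (Eu n × Eu m) × Eu k) (F := JetModel n m) Ψ (poincareCartan L)) r

end lagrangian

end JetField

end

open JetField

namespace JetField

universe u v

/-! ### Exterior derivative and pull-back on manifolds -/

section general
variable {E F : Type*} [NormedAddCommGroup E] [NormedSpace ℝ E] [NormedAddCommGroup F]
  [NormedSpace ℝ F] {M N : Type*} [TopologicalSpace M] [ChartedSpace E M] [TopologicalSpace N]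
  [ChartedSpace F N]

/-! In fibred coordinates `H_L = p^λ_i dy^i ∧ ω_λ - (p^λ_i y^i_λ - ℒ) ω` with `p = ∂ℒ/∂y^i_λ`, so at
a jet it depends only on the base point in `Y`, the momentum and the energy. The first two are
constant on the fibres of the Legendre map by definition. The energy is too: such a fibre lies over
one point of `Y`, the momentum is fixed along it, hence the fibre derivative of `ℒ - p^λ_i y^i_λ` is
`∂ℒ/∂y^i_λ - p^λ_i = 0`, and the fibres are connected (`coordLagrangian_sub_eq`). Consequently
`Φ^*H_L = H_L` for every smooth `Φ` preserving the Legendre map (`pullback_poincareCartan`). With `Φ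
= Ψ ∘ L̂` this says that `H_L` is the pull-back of `H_N` by `L̂`, and since `d` commutes with
pull-backs (`extDerivAt_pullback`), `dH_L` is the pull-back of `dH_N`.

Hence `s^*(u ⌋ dH_L)` equals `r^*(TL̂ u ⌋ dH_N)` pointwise, and both systems of equations involve a
vertical field only through its value at one point. It remains to match the available values. `TL̂`
is onto (`surjective_dAt_of_isSubmersion`) and compatible with the projections to `X`; a vertical
vector on `J¹Y` extends to a vertical field by a bump function (`exists_isVerticalField_jet`); a
vertical vector on `N_L` extends by lifting it to `J¹Y` at a point of the section `Ψ`, extending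
there, and pushing forward along `Ψ` (`IsVerticalField.pushforward`). -/

theorem dAt_eq_fderiv_chart {f : M → N} {x : M}
    (hf : MDifferentiableAt 𝓘(ℝ, E) 𝓘(ℝ, F) f x) :
    dAt E F f x = fderiv ℝ (chartAt F (f x) ∘ f ∘ (chartAt E x).symm) (chartAt E x x) := by
  have h : dAt E F f x = fderivWithin ℝ (writtenInExtChartAt 𝓘(ℝ, E) 𝓘(ℝ, F) x f)
      (range 𝓘(ℝ, E)) (extChartAt 𝓘(ℝ, E) x x) := hf.mfderiv
  rw [h]
  simp only [modelWithCornersSelf_coe, range_id, fderivWithin_univ]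
  rfl

/-- The exterior differential commutes with pull-backs. -/
theorem extDerivAt_pullback [IsManifold 𝓘(ℝ, E) ∞ M] [IsManifold 𝓘(ℝ, F) ∞ N] {k : ℕ}
    {f : M → N} (hf : ContMDiff 𝓘(ℝ, E) 𝓘(ℝ, F) ∞ f) {H : N → F [⋀^Fin k]→L[ℝ] ℝ} {x : M}
    (hH : DifferentiableAt ℝ (fun q => (H ((chartAt F (f x)).symm q)).compContinuousLinearMap
      (dAt F F (chartAt F (f x)).symm q)) (chartAt F (f x) (f x))) :
    extDerivAt (pullback (E := E) (F := F) f H) x =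
      (extDerivAt H (f x)).compContinuousLinearMap (dAt E F f x) := by
  set φ := chartAt E x with hφ
  set ψ := chartAt F (f x) with hψ
  have hφs : ContMDiffOn 𝓘(ℝ, E) 𝓘(ℝ, E) ∞ φ.symm φ.target := contMDiffOn_chart_symm
  have hψ1 : ContMDiffOn 𝓘(ℝ, F) 𝓘(ℝ, F) ∞ ψ ψ.source := contMDiffOn_chart
  have hψs : ContMDiffOn 𝓘(ℝ, F) 𝓘(ℝ, F) ∞ ψ.symm ψ.target := contMDiffOn_chart_symm
  set g : E → F := ψ ∘ f ∘ φ.symm with hg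
  have hxφ : φ x ∈ φ.target := φ.map_source (mem_chart_source E x)
  have hx0 : φ.symm (φ x) = x := φ.left_inv (mem_chart_source E x)
  have hgx : g (φ x) = ψ (f x) := by simp [hg, hx0]
  have hgs : ContDiffAt ℝ ∞ g (φ x) := by
    rw [← contMDiffAt_iff_contDiffAt]
    refine ContMDiffAt.comp (φ x) (I' := 𝓘(ℝ, F)) ?_ (ContMDiffAt.comp (φ x) (I' := 𝓘(ℝ, E)) hf.contMDiffAt
      (hφs.contMDiffAt (φ.open_target.mem_nhds hxφ)))
    refine hψ1.contMDiffAt (ψ.open_source.mem_nhds ?_)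
    simp only [comp_apply, hx0]
    exact mem_chart_source F (f x)
  have hU : φ.target ∩ φ.symm ⁻¹' (f ⁻¹' ψ.source) ∈ 𝓝 (φ x) := by
    refine (φ.isOpen_inter_preimage_symm (ψ.open_source.preimage hf.continuous)).mem_nhds ⟨hxφ, ?_⟩
    simp only [mem_preimage, hx0]
    exact mem_chart_source F (f x)
  -- Near `φ x` the local expression of `f^*H` is the pull-back by `g` of the local expression of
  -- `H`, because the differentials of `ψ` and `ψ.symm` cancel. This reduces the claim to normed
  -- spaces.
  have hev : (fun q => (pullback (E := E) (F := F) f H (φ.symm q)).compContinuousLinearMap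
      (dAt E E φ.symm q)) =ᶠ[𝓝 (φ x)]
      fun q => ((H (ψ.symm (g q))).compContinuousLinearMap
        (dAt F F ψ.symm (g q))).compContinuousLinearMap (fderiv ℝ g q) := by
    filter_upwards [hU] with q hq
    have h1 : ψ.symm (g q) = f (φ.symm q) := ψ.left_inv hq.2
    have d1 := mdiffAt_of_smoothOn hφs φ.open_target hq.1
    have d2 : MDifferentiableAt 𝓘(ℝ, E) 𝓘(ℝ, F) f (φ.symm q) :=
      hf.contMDiffAt.mdifferentiableAt (by simp)
    have d3 := mdiffAt_of_smoothOn hψ1 ψ.open_source hq.2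
    have h2 : fderiv ℝ g q = (dAt F F ψ (f (φ.symm q))).comp
        ((dAt E F f (φ.symm q)).comp (dAt E E φ.symm q)) := by
      have h := dAt_comp (f := f ∘ φ.symm) d3 (d2.comp q d1)
      rw [dAt_comp d2 d1] at h
      rw [← dAt_eq_fderiv]
      exact h
    have h3 := dAt_symm_comp ψ hψ1 hψs hq.2
    have h4 : (dAt F F ψ.symm (g q)).comp (fderiv ℝ g q) =
        (dAt E F f (φ.symm q)).comp (dAt E E φ.symm q) := by
      rw [h2, ← ContinuousLinearMap.comp_assoc]
      change ((dAt F F ψ.symm (ψ (f (φ.symm q)))).comp (dAt F F ψ (f (φ.symm q)))).comp _ = _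
      rw [h3, ContinuousLinearMap.id_comp]
    rw [h1]
    ext v
    have h5 := fun v => DFunLike.congr_fun h4 v
    simp only [ContinuousLinearMap.comp_apply] at h5
    simp [pullback, comp_def, h5]
  have hH' : DifferentiableAt ℝ (fun p => (H (ψ.symm p)).compContinuousLinearMap
      (dAt F F ψ.symm p)) (g (φ x)) := by rwa [hgx]
  -- The side condition asks that `g` be at least `C²`, for the symmetry of its second derivative.
  rw [extDerivAt, hev.extDeriv_eq, extDeriv_pullback (r := ∞) hH' hgs
    (by simpa using WithTop.coe_le_coe.2 (le_top : (2 : ℕ∞) ≤ ⊤)), hgx, dAt_eq_fderiv_chart (hf.contMDiffAt.mdifferentiableAt (by simp))]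
  rfl

end general

/-! ### Linear algebra of top-degree forms -/

section algebra
variable {n : ℕ} {V : Type*} [NormedAddCommGroup V] [NormedSpace ℝ V]

/-- The expansion of a linear endomorphism can be moved between the two slots of the canonical
element `dx^l ⊗ ∂_l`. -/
theorem sum_proj_comp (f : (Eu n →L[ℝ] ℝ) →ₗ[ℝ] ℝ) (g : Eu n →ₗ[ℝ] ℝ) (C : Eu n →L[ℝ] Eu n) :
    ∑ l, f ((EuclideanSpace.proj l : Eu n →L[ℝ] ℝ).comp C) * g (stdVec n l) =
      ∑ l, f (EuclideanSpace.proj l : Eu n →L[ℝ] ℝ) * g (C (stdVec n l)) := by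
  have hx : ∀ a : Eu n, a = ∑ k, a k • stdVec n k := by
    intro a; ext i; simp [stdVec, Pi.single_apply]
  -- Both sides become the same double sum over the matrix entries of `C`, with the two indices
  -- exchanged.
  have h1 : ∀ l, (EuclideanSpace.proj l : Eu n →L[ℝ] ℝ).comp C =
      ∑ k, (C (stdVec n k)) l • (EuclideanSpace.proj k : Eu n →L[ℝ] ℝ) := by
    intro l
    ext a
    conv_lhs => rw [hx a]
    simp [mul_comm]
  have h2 : ∀ l, g (C (stdVec n l)) = ∑ k, (C (stdVec n l)) k * g (stdVec n k) := by
    intro l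
    conv_lhs => rw [hx (C (stdVec n l))]
    simp
  simp only [h1, h2, map_sum, map_smul, smul_eq_mul, Finset.sum_mul, Finset.mul_sum]
  rw [Finset.sum_comm]
  exact Finset.sum_congr rfl fun _ _ => Finset.sum_congr rfl fun _ _ => by ring

theorem stdVol_update (j l : Fin n) :
    stdVol n (update (stdVec n) j (stdVec n l)) = if j = l then 1 else 0 := by
  split_ifs with h
  · subst h; rw [update_eq_self, stdVol_stdVec]
  · refine (stdVol n).map_eq_zero_of_eq _ (i := j) (j := l) ?_ h
    simp [update_of_ne (Ne.symm h)]

/-- An endomorphism acts on `n`-forms on `ℝⁿ` as a derivation by its trace. -/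
theorem sum_slotForm_stdVol (p : (Eu n →L[ℝ] V) →L[ℝ] ℝ) (δ : Eu n →L[ℝ] V) (w : Fin n → Eu n) :
    ∑ l, ∑ j, p ((EuclideanSpace.proj l : Eu n →L[ℝ] ℝ).smulRight (δ (w j))) *
        stdVol n (update w j (stdVec n l)) = p δ * stdVol n w := by
  -- As a function of `w` the left side is a top form, hence determined by its value on the standard
  -- basis. There only the terms `j = l` survive, and they add up to `p` of the expansion `δ = ∑
  -- dx^l ⊗ δ(∂_l)`.
  let η : TopForm n := ∑ l, slotForm (((p.comp
    ((ContinuousLinearMap.smulRightL ℝ (Eu n) V (EuclideanSpace.proj l)).comp δ))).smulRight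
      (stdVol n)) (ContinuousLinearMap.id ℝ (Eu n)) (stdVec n l)
  have hη : ∀ w, η w = ∑ l, ∑ j, p ((EuclideanSpace.proj l : Eu n →L[ℝ] ℝ).smulRight (δ (w j))) *
        stdVol n (update w j (stdVec n l)) := by
    intro w
    simp only [η, ContinuousAlternatingMap.sum_apply]
    rfl
  rw [← hη, TopForm.eq_smul η, ContinuousAlternatingMap.smul_apply, smul_eq_mul, hη]
  congr 1
  simp only [stdVol_update, mul_ite, mul_one, mul_zero, Finset.sum_ite_eq', Finset.mem_univ, if_true,
    ← map_sum]
  congr 1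
  have hx : ∀ a : Eu n, a = ∑ k, a k • stdVec n k := by
    intro a; ext i; simp [stdVec, Pi.single_apply]
  ext1 a
  conv_rhs => rw [hx a]
  simp

end algebra

section

/-! ### Calculus for the coordinate expressions -/

section forms
variable {n : ℕ} {V : Type*} [NormedAddCommGroup V] [NormedSpace ℝ V]

/-- The `n`-form `α ∧ p^*(a ⌋ dx¹ ∧ ⋯ ∧ dxⁿ)`, as a linear function of the `1`-form `α`. -/
noncomputable def wedgeContract (p : V →L[ℝ] Eu n) (a : Eu n) :
    (V →L[ℝ] ℝ) →ₗ[ℝ] V [⋀^Fin n]→L[ℝ] ℝ where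
  toFun α := slotForm (α.smulRight (stdVol n)) p a
  map_add' α β := by
    ext v
    change ∑ j, (α (v j) + β (v j)) * _ = ∑ j, α (v j) * _ + ∑ j, β (v j) * _
    simp [add_mul, Finset.sum_add_distrib]
  map_smul' c α := by
    ext v
    change ∑ j, (c * α (v j)) * _ = c * ∑ j, α (v j) * _
    simp [mul_assoc, Finset.mul_sum]

/-- `wedgeContract p a` is linear on a finite-dimensional space, hence continuous and smooth, so
smooth coefficients give a smooth form. -/
theorem contDiffOn_add_sum_wedgeContract {G : Type*} [NormedAddCommGroup G] [NormedSpace ℝ G]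
    [FiniteDimensional ℝ V] {U : Set G} {f : G → ℝ} {α : Fin n → G → V →L[ℝ] ℝ}
    (hf : ContDiffOn ℝ ∞ f U) (hα : ∀ l, ContDiffOn ℝ ∞ (α l) U) (p : V →L[ℝ] Eu n) :
    ContDiffOn ℝ ∞ (fun q => f q • (stdVol n).compContinuousLinearMap p +
      ∑ l, wedgeContract p (stdVec n l) (α l q)) U :=
  (hf.smul contDiffOn_const).add (ContDiffOn.sum fun l _ =>
    (LinearMap.toContinuousLinearMap
      (wedgeContract p (stdVec n l))).contDiff.comp_contDiffOn (hα l))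

/-- The chain rule behind the Legendre map: `q` is a jet in coordinates, `S` turns an intrinsic
fibre displacement into coordinates, and `τ` is the volume form at the base point. -/
theorem fderiv_comp_inr_smul {A B W T : Type*} [NormedAddCommGroup A] [NormedSpace ℝ A]
    [NormedAddCommGroup B] [NormedSpace ℝ B] [NormedAddCommGroup W] [NormedSpace ℝ W]
    [NormedAddCommGroup T] [NormedSpace ℝ T] {f : A × B → ℝ} {q : A × B}
    (hf : DifferentiableAt ℝ f q) (S : W →L[ℝ] B) (τ : T) :
    fderiv ℝ (fun φ => f (q + (0, S φ)) • τ) 0 =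
      (((fderiv ℝ f q).comp (.inr ℝ A B)).comp S).smulRight τ := by
  have h1 : HasFDerivAt (fun φ : W => q + ((0 : A), S φ))
      ((ContinuousLinearMap.inr ℝ A B).comp S) 0 :=
    ((ContinuousLinearMap.inr ℝ A B).comp S).hasFDerivAt.const_add _
  have h2 : HasFDerivAt f (fderiv ℝ f q) (q + ((0 : A), S 0)) := by
    have h0 : ((0 : A), S 0) = 0 := by rw [map_zero]; rfl
    rw [h0, add_zero]
    exact hf.hasFDerivAt
  exact ((h2.comp (0 : W) h1).smul_const τ).fderiv

end forms

variable {n m : ℕ} {X : Type v} {Y : Type u} [TopologicalSpace X] [ChartedSpace (Eu n) X]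
  [TopologicalSpace Y] [ChartedSpace (Eu n × Eu m) Y] {π : Y → X}

theorem FibredChart.eq_smul_vol (c : FibredChart n m π) {x : X} (hx : x ∈ c.base.source)
    (η : TopForm n) :
    η = η (fun i => dAt (Eu n) (Eu n) c.base.symm (c.base x) (stdVec n i)) •
      (stdVol n).compContinuousLinearMap (dAt (Eu n) (Eu n) c.base x) := by
  have h3 := fun v => DFunLike.congr_fun (c.base_symm_dAt hx) v
  simp only [ContinuousLinearMap.comp_apply, ContinuousLinearMap.id_apply] at h3
  have := TopForm.eq_smul
    (η.compContinuousLinearMap (dAt (Eu n) (Eu n) c.base.symm (c.base x)))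
  ext v
  have := congrArg (fun f : TopForm n => f fun i => dAt (Eu n) (Eu n) c.base x (v i)) this
  simp [comp_def, h3] at this
  simp [comp_def, ← this]

/-! ### Adapted charts of the jet manifold -/

section charts
variable [IsManifold 𝓘(ℝ, Eu n) ∞ X] [hπ : IsSmoothFibreBundle (Eu n) m π]

/-- The adapted chart `(x^λ, y^i, y^i_λ)` as a chart of the manifold `J¹Y`. -/
noncomputable def FibredChart.jetHomeo (c : FibredChart n m π) :
    OpenPartialHomeomorph (Jet n m π) (JetModel n m) :=
  (jetCore n m π).openPartialHomeomorph c.jetChart (mem_range_self c)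

namespace FibredChart
variable (c : FibredChart n m π)

theorem jetHomeo_apply (z : Jet n m π) : c.jetHomeo z = c.jetCoord z := rfl

theorem fst_jetHomeo (z : Jet n m π) : (c.jetHomeo z).1 = c.tot z.pt := rfl

theorem jetHomeo_mem_maximalAtlas :
    c.jetHomeo ∈ IsManifold.maximalAtlas 𝓘(ℝ, JetModel n m) ∞ (Jet n m π) := by
  refine IsManifold.subset_maximalAtlas ?_
  change _ ∈ ⋃ (e : PartialEquiv (Jet n m π) (JetModel n m)) (he : e ∈ (jetCore n m π).atlas),
    {(jetCore n m π).openPartialHomeomorph e he}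
  simp only [mem_iUnion, mem_singleton_iff]
  exact ⟨_, mem_range_self c, rfl⟩

theorem jetHomeo_smooth :
    ContMDiffOn 𝓘(ℝ, JetModel n m) 𝓘(ℝ, JetModel n m) ∞ c.jetHomeo c.jetHomeo.source :=
  contMDiffOn_of_mem_maximalAtlas c.jetHomeo_mem_maximalAtlas

theorem jetHomeo_symm_smooth :
    ContMDiffOn 𝓘(ℝ, JetModel n m) 𝓘(ℝ, JetModel n m) ∞ c.jetHomeo.symm c.jetHomeo.target :=
  contMDiffOn_symm_of_mem_maximalAtlas c.jetHomeo_mem_maximalAtlas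

omit hπ in
theorem base_mem_maximalAtlas : c.base ∈ IsManifold.maximalAtlas 𝓘(ℝ, Eu n) ∞ X :=
  c.base.mem_maximalAtlas_of_contMDiffOn c.base_smooth c.base_symm_smooth

end FibredChart

theorem contMDiff_pt : ContMDiff 𝓘(ℝ, JetModel n m) 𝓘(ℝ, Eu n × Eu m) ∞
    (Jet.pt : Jet n m π → Y) := by
  intro z
  set c := fibredChartAt n m π z.pt
  have hz : z.pt ∈ c.tot.source := mem_fibredChartAt z.pt
  have h1 : ContMDiffAt 𝓘(ℝ, JetModel n m) 𝓘(ℝ, JetModel n m) ∞ c.jetHomeo z :=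
    c.jetHomeo_smooth.contMDiffAt (c.jetHomeo.open_source.mem_nhds hz)
  have h2 : ContMDiffAt 𝓘(ℝ, JetModel n m) 𝓘(ℝ, Eu n × Eu m) ∞
      (Prod.fst : JetModel n m → Eu n × Eu m) (c.jetHomeo z) := contDiff_fst.contMDiff.contMDiffAt
  have h3 : ContMDiffAt 𝓘(ℝ, Eu n × Eu m) 𝓘(ℝ, Eu n × Eu m) ∞ c.tot.symm (c.jetHomeo z).1 :=
    c.tot_symm_smooth.contMDiffAt (c.tot.open_target.mem_nhds (c.tot.map_source hz))
  refine (h3.comp z (h2.comp z h1)).congr_of_eventuallyEq ?_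
  filter_upwards [c.jetHomeo.open_source.mem_nhds hz] with w hw
  exact (c.tot.left_inv hw).symm

theorem contMDiff_proj_pt : ContMDiff 𝓘(ℝ, JetModel n m) 𝓘(ℝ, Eu n) ∞
    (fun z : Jet n m π => π z.pt) :=
  hπ.contMDiff.comp contMDiff_pt

/-- In adapted coordinates the projection `J¹Y → Y` is `(x, y, y_λ) ↦ (x, y)`. All later
computations of `Tπ` and of the contact form go through this identity. -/
theorem FibredChart.dAt_tot_comp_dAt_pt (c : FibredChart n m π) {z : Jet n m π}
    (hz : z.pt ∈ c.tot.source) :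
    (dAt (Eu n × Eu m) (Eu n × Eu m) c.tot z.pt).comp
      (dAt (JetModel n m) (Eu n × Eu m) (Jet.pt : Jet n m π → Y) z) =
    (ContinuousLinearMap.fst ℝ (Eu n × Eu m) (Eu n →L[ℝ] Eu m)).comp
      (dAt (JetModel n m) (JetModel n m) c.jetHomeo z) := by
  have h1 : dAt (JetModel n m) (Eu n × Eu m) (Prod.fst : JetModel n m → Eu n × Eu m)
      (c.jetHomeo z) = ContinuousLinearMap.fst ℝ (Eu n × Eu m) (Eu n →L[ℝ] Eu m) := by
    rw [dAt_eq_fderiv, fderiv_fst]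
  rw [← h1, ← dAt_comp (mdiffAt_of_smoothOn c.tot_smooth c.tot.open_source hz)
      (contMDiff_pt.contMDiffAt.mdifferentiableAt (by simp)),
    ← dAt_comp differentiableAt_fst.mdifferentiableAt
      (mdiffAt_of_smoothOn c.jetHomeo_smooth c.jetHomeo.open_source hz)]
  rfl

/-! ### The Lagrangian in adapted coordinates -/

section lagrangian
variable (L : Lagrangian n m π) (c : FibredChart n m π)

/-- The coefficient `ℒ` of a Lagrangian in an adapted chart. -/
noncomputable def coordLagrangian (q : JetModel n m) : ℝ :=
  L.toFun (c.jetHomeo.symm q) fun i => dAt (Eu n) (Eu n) c.base.symm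
    (c.base (π (c.jetHomeo.symm q).pt)) (stdVec n i)

theorem contDiffOn_coordLagrangian :
    ContDiffOn ℝ ∞ (coordLagrangian L c) c.jetHomeo.target := by
  rw [← contMDiffOn_iff_contDiffOn]
  refine (L.smooth c.base c.base_mem_maximalAtlas).comp c.jetHomeo_symm_smooth fun q hq => ?_
  exact c.proj_mem _ (c.jetHomeo.map_target hq)

theorem differentiableAt_coordLagrangian {q : JetModel n m} (hq : q ∈ c.jetHomeo.target) :
    DifferentiableAt ℝ (coordLagrangian L c) q :=
  ((contDiffOn_coordLagrangian L c).contDiffAt (c.jetHomeo.open_target.mem_nhds hq)).differentiableAt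
    (by simp)

theorem coordLagrangian_jetHomeo {z : Jet n m π} (hz : z.pt ∈ c.tot.source) :
    coordLagrangian L c (c.jetHomeo z) = L.toFun z fun i => dAt (Eu n) (Eu n) c.base.symm
      (c.base (π z.pt)) (stdVec n i) := by
  rw [coordLagrangian, c.jetHomeo.left_inv hz]

theorem toFun_eq_coordLagrangian_smul {z : Jet n m π} (hz : z.pt ∈ c.tot.source) :
    L.toFun z = coordLagrangian L c (c.jetHomeo z) •
      (stdVol n).compContinuousLinearMap (dAt (Eu n) (Eu n) c.base (π z.pt)) := by
  rw [coordLagrangian_jetHomeo L c hz]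
  exact c.eq_smul_vol (c.proj_mem _ hz) _

omit [IsManifold 𝓘(ℝ, Eu n) ∞ X] hπ in
-- The linear part of a jet enters its coordinates linearly, so adapted charts respect the affine
-- structure of `J¹Y → Y`. This is what makes the intrinsic fibre derivative of `L` equal to
-- `∂ℒ/∂y^i_λ`.
theorem jetCoord_translate (z : Jet n m π) (φ : Eu n →L[ℝ] Vert n m π z.pt) :
    c.jetCoord (z.translate φ) = c.jetCoord z + (0, sandwich (c.vertCoord z.pt)
      (dAt (Eu n) (Eu n) c.base.symm (c.base (π z.pt))) φ) := by
  ext1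
  · simp [FibredChart.jetCoord, Jet.translate]
  · simp only [FibredChart.jetCoord, Jet.translate, ContinuousLinearMap.add_comp,
      ContinuousLinearMap.comp_add]
    rfl

/-- The derivative `∂ℒ/∂y^i_λ` in an adapted chart, as a linear functional. -/
noncomputable def coordMomentum (q : JetModel n m) : (Eu n →L[ℝ] Eu m) →L[ℝ] ℝ :=
  (fderiv ℝ (coordLagrangian L c) q).comp (.inr ℝ (Eu n × Eu m) (Eu n →L[ℝ] Eu m))

end lagrangian
end charts

end

/-! ### Momenta and the Poincaré–Cartan form in adapted coordinates -/

section

variable {n m : ℕ} {X : Type v} {Y : Type u} [TopologicalSpace X] [ChartedSpace (Eu n) X]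
  [TopologicalSpace Y] [ChartedSpace (Eu n × Eu m) Y] {π : Y → X}
  [IsManifold 𝓘(ℝ, Eu n) ∞ X] [hπ : IsSmoothFibreBundle (Eu n) m π]
  (L : Lagrangian n m π) (c : FibredChart n m π)

theorem toFun_translate {z : Jet n m π} (hz : z.pt ∈ c.tot.source)
    (φ : Eu n →L[ℝ] Vert n m π z.pt) :
    L.toFun (z.translate φ) = coordLagrangian L c (c.jetHomeo z + (0, sandwich (c.vertCoord z.pt)
        (dAt (Eu n) (Eu n) c.base.symm (c.base (π z.pt))) φ)) •
      (stdVol n).compContinuousLinearMap (dAt (Eu n) (Eu n) c.base (π z.pt)) := by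
  rw [toFun_eq_coordLagrangian_smul L c (z := z.translate φ) hz, c.jetHomeo_apply,
    jetCoord_translate]
  rfl

theorem fderiv_coordLagrangian_smul {z : Jet n m π} (hz : z.pt ∈ c.tot.source) :
    fderiv ℝ (fun φ => coordLagrangian L c (c.jetHomeo z + (0, sandwich (c.vertCoord z.pt)
        (dAt (Eu n) (Eu n) c.base.symm (c.base (π z.pt))) φ)) •
      (stdVol n).compContinuousLinearMap (dAt (Eu n) (Eu n) c.base (π z.pt))) 0 =
    c.mkMom z.pt (coordMomentum L c (c.jetHomeo z)) :=
  fderiv_comp_inr_smul (differentiableAt_coordLagrangian L c (c.jetHomeo.map_source hz))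
    (sandwich (c.vertCoord z.pt) (dAt (Eu n) (Eu n) c.base.symm (c.base (π z.pt))))
    ((stdVol n).compContinuousLinearMap (dAt (Eu n) (Eu n) c.base (π z.pt)))

theorem legendreMap_mom {z : Jet n m π} (hz : z.pt ∈ c.tot.source) :
    (legendreMap L z).mom = c.mkMom z.pt (coordMomentum L c (c.jetHomeo z)) :=
  (congrArg (fun f => fderiv ℝ f 0) (funext fun φ => toFun_translate L c hz φ)).trans
    (fderiv_coordLagrangian_smul L c hz)

/-- The coordinate expression of the Poincaré–Cartan form. -/
noncomputable def coordPoincareCartan (q : JetModel n m) : JetModel n m [⋀^Fin n]→L[ℝ] ℝ :=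
  coordLagrangian L c q • (stdVol n).compContinuousLinearMap
      ((ContinuousLinearMap.fst ℝ (Eu n) (Eu m)).comp
        (ContinuousLinearMap.fst ℝ (Eu n × Eu m) (Eu n →L[ℝ] Eu m))) +
    ∑ l : Fin n, wedgeContract ((ContinuousLinearMap.fst ℝ (Eu n) (Eu m)).comp
        (ContinuousLinearMap.fst ℝ (Eu n × Eu m) (Eu n →L[ℝ] Eu m))) (stdVec n l)
      ((coordMomentum L c q).comp
        ((ContinuousLinearMap.smulRightL ℝ (Eu n) (Eu m) (EuclideanSpace.proj l)).comp
          ((ContinuousLinearMap.snd ℝ (Eu n) (Eu m)).comp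
              (ContinuousLinearMap.fst ℝ (Eu n × Eu m) (Eu n →L[ℝ] Eu m)) -
            q.2.comp ((ContinuousLinearMap.fst ℝ (Eu n) (Eu m)).comp
              (ContinuousLinearMap.fst ℝ (Eu n × Eu m) (Eu n →L[ℝ] Eu m))))))

theorem coordPoincareCartan_apply (q : JetModel n m) (v : Fin n → JetModel n m) :
    coordPoincareCartan L c q v = coordLagrangian L c q * stdVol n (fun i => (v i).1.1) +
      ∑ l, ∑ j, coordMomentum L c q ((EuclideanSpace.proj l : Eu n →L[ℝ] ℝ).smulRight
          ((v j).1.2 - q.2 (v j).1.1)) *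
        stdVol n (update (fun i => (v i).1.1) j (stdVec n l)) := by
  simp only [coordPoincareCartan, ContinuousAlternatingMap.add_apply,
    ContinuousAlternatingMap.sum_apply, ContinuousAlternatingMap.smul_apply, smul_eq_mul]
  rfl

theorem contDiffOn_coordPoincareCartan :
    ContDiffOn ℝ ∞ (coordPoincareCartan L c) c.jetHomeo.target := by
  have h0 := contDiffOn_coordLagrangian L c
  have h1 : ContDiffOn ℝ ∞ (coordMomentum L c) c.jetHomeo.target :=
    (h0.fderiv_of_isOpen c.jetHomeo.open_target (by simp)).clm_comp contDiffOn_const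
  exact contDiffOn_add_sum_wedgeContract h0 (fun l => h1.clm_comp (contDiffOn_const.clm_comp
    (contDiffOn_const.sub (contDiff_snd.contDiffOn.clm_comp contDiffOn_const)))) _

/-- The intrinsic form is built with the base vectors of the preferred chart of `X`, the coordinate
form with those of `c`. They agree because `∑ dx^l ⊗ ∂_l` does not depend on the basis, which is
`sum_proj_comp`. -/
theorem poincareCartan_eq {z : Jet n m π} (hz : z.pt ∈ c.tot.source) :
    poincareCartan L z = (coordPoincareCartan L c (c.jetHomeo z)).compContinuousLinearMap
      (dAt (JetModel n m) (JetModel n m) c.jetHomeo z) := by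
  have hx := c.proj_mem _ hz
  set A := dAt (Eu n) (Eu n) c.base (π z.pt) with hA
  set A' := dAt (Eu n) (Eu n) c.base.symm (c.base (π z.pt)) with hA'
  set P := (dAt (Eu n × Eu m) (Eu n) π z.pt).comp
      (dAt (JetModel n m) (Eu n × Eu m) (Jet.pt : Jet n m π → Y) z) with hP
  set D := dAt (JetModel n m) (JetModel n m) c.jetHomeo z with hD
  set p := coordMomentum L c (c.jetHomeo z) with hp
  have k1 : ∀ w, A' (A w) = w := fun v => DFunLike.congr_fun (c.base_symm_dAt hx) v
  have k2 : ∀ w, A (A' w) = w := fun v => DFunLike.congr_fun (c.base_dAt_symm hx) v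
  have k3 : ∀ v, dAt (Eu n × Eu m) (Eu n × Eu m) c.tot z.pt
      (dAt (JetModel n m) (Eu n × Eu m) (Jet.pt : Jet n m π → Y) z v) = (D v).1 :=
    fun v => DFunLike.congr_fun (c.dAt_tot_comp_dAt_pt hz) v
  have k4 : ∀ v, A (P v) = (D v).1.1 := fun v => by
    rw [← k3]
    exact (DFunLike.congr_fun (c.fst_comp_dAt hz) _).symm
  -- The coordinate form `dy^i - y^i_λ dx^λ` of the contact form.
  have k5 : ∀ v, c.vertCoord z.pt (contactForm z v) =
      (D v).1.2 - (c.jetHomeo z).2 (D v).1.1 := fun v => by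
    rw [← k4, ← k3]
    change (dAt (Eu n × Eu m) (Eu n × Eu m) c.tot z.pt
      (dAt (JetModel n m) (Eu n × Eu m) (Jet.pt : Jet n m π → Y) z v - z.lin (P v))).2 =
      _ - (dAt (Eu n × Eu m) (Eu n × Eu m) c.tot z.pt (z.lin (A' (A (P v))))).2
    rw [k1, map_sub, Prod.snd_sub]
  ext v
  rw [ContinuousAlternatingMap.compContinuousLinearMap_apply, coordPoincareCartan_apply]
  have hL : (L.toFun z) (fun i => P (v i)) =
      coordLagrangian L c (c.jetHomeo z) * stdVol n (fun i => (D (v i)).1.1) := by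
    conv_lhs => rw [toFun_eq_coordLagrangian_smul L c hz]
    change _ * stdVol n (fun i => A (P (v i))) = _
    simp only [k4]
  have hmom : ∀ (l j : Fin n) (w : Fin n → Eu n), (legendreMap L z).mom
      ((EuclideanSpace.proj l : Eu n →L[ℝ] ℝ).smulRight (contactForm z (v j))) w =
      p (((EuclideanSpace.proj l : Eu n →L[ℝ] ℝ).comp A').smulRight
        ((D (v j)).1.2 - (c.jetHomeo z).2 (D (v j)).1.1)) * stdVol n (fun i => A (w i)) := by
    intro l j w
    rw [legendreMap_mom L c hz]
    change p (sandwich _ _ _) * stdVol n (fun i => A (w i)) = _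
    have hs : sandwich (c.vertCoord z.pt) A'
        ((EuclideanSpace.proj l : Eu n →L[ℝ] ℝ).smulRight (contactForm z (v j))) =
        ((EuclideanSpace.proj l : Eu n →L[ℝ] ℝ).comp A').smulRight
          ((D (v j)).1.2 - (c.jetHomeo z).2 (D (v j)).1.1) := by
      ext1 a
      rw [← k5, sandwich_apply]
      simp
    exact congrArg (· * stdVol n fun i => A (w i)) (congrArg p hs)
  change (L.toFun z) (fun i => P (v i)) + (∑ l, slotForm _ _ _ : JetModel n m [⋀^Fin n]→L[ℝ] ℝ) v = _
  rw [hL, ContinuousAlternatingMap.sum_apply]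
  congr 1
  change ∑ l, ∑ j, (legendreMap L z).mom
      ((EuclideanSpace.proj l : Eu n →L[ℝ] ℝ).smulRight (contactForm z (v j)))
        (update (fun i => P (v i)) j (stdVec n l)) = _
  simp only [hmom]
  rw [Finset.sum_comm]
  conv_rhs => rw [Finset.sum_comm]
  refine Finset.sum_congr rfl fun j _ => ?_
  -- With the slot `j` fixed, each summand is linear in the covector (through `f`) and in the base
  -- vector (through `g`). The factor `A'` on the covector can therefore be moved to the vector,
  -- where it cancels the `A` inside `g`.
  let f : (Eu n →L[ℝ] ℝ) →ₗ[ℝ] ℝ := (p.comp ((ContinuousLinearMap.smulRightL ℝ (Eu n) (Eu m)).flip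
    ((D (v j)).1.2 - (c.jetHomeo z).2 (D (v j)).1.1))).toLinearMap
  let g : Eu n →ₗ[ℝ] ℝ := (stdVol n).toMultilinearMap.toLinearMap (fun i => (D (v i)).1.1) j ∘ₗ
    A.toLinearMap
  have hg : ∀ a, g a = stdVol n (update (fun i => (D (v i)).1.1) j (A a)) := fun a => rfl
  have hg' : ∀ a, stdVol n (fun i => A (update (fun i => P (v i)) j a i)) = g a := by
    intro a
    rw [hg]
    congr 1
    ext1 i
    by_cases h : i = j
    · subst h; simp
    · simp [h, k4]
  have := sum_proj_comp f g A'
  simp only [hg']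
  refine this.trans (Finset.sum_congr rfl fun l _ => ?_)
  rw [hg, k2]
  rfl

/-- The local expression of `H_L` coincides near `q` with the smooth `coordPoincareCartan`, the
differentials of the chart and its inverse cancelling. This provides the differentiability needed to
pull back `dH_L`. -/
theorem differentiableAt_poincareCartan {q : JetModel n m} (hq : q ∈ c.jetHomeo.target) :
    DifferentiableAt ℝ (fun q => (poincareCartan L (c.jetHomeo.symm q)).compContinuousLinearMap
      (dAt (JetModel n m) (JetModel n m) c.jetHomeo.symm q)) q := by
  have h := ((contDiffOn_coordPoincareCartan L c).contDiffAt
    (c.jetHomeo.open_target.mem_nhds hq)).differentiableAt (by simp)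
  refine h.congr_of_eventuallyEq ?_
  filter_upwards [c.jetHomeo.open_target.mem_nhds hq] with q hq
  have h1 := fun v => DFunLike.congr_fun (dAt_comp_symm _ c.jetHomeo_smooth c.jetHomeo_symm_smooth
    (c.jetHomeo.map_target hq)) v
  rw [c.jetHomeo.right_inv hq] at h1
  rw [poincareCartan_eq L c (c.jetHomeo.map_target hq), c.jetHomeo.right_inv hq]
  ext v
  simp only [ContinuousLinearMap.comp_apply, ContinuousLinearMap.id_apply] at h1
  simp [comp_def, h1]

end

section

/-! ### Functions on the fibres of a submersion -/

section general
variable {E F : Type*} [NormedAddCommGroup E] [NormedSpace ℝ E] [NormedAddCommGroup F]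
  [NormedSpace ℝ F] {M N : Type*} [TopologicalSpace M] [ChartedSpace E M] [TopologicalSpace N]
  [ChartedSpace F N]

/-- A function whose differential vanishes along a submersion is locally constant on the fibres. -/
theorem eventually_eq_of_isSubmersionAt [IsManifold 𝓘(ℝ, E) ∞ M] [IsManifold 𝓘(ℝ, F) ∞ N]
    {f : M → N} {x : M} (hf : Manifold.IsSubmersion 𝓘(ℝ, E) 𝓘(ℝ, F) ∞ f) {G : M → ℝ}
    (hG : ∀ z, f z = f x → MDifferentiableAt 𝓘(ℝ, E) 𝓘(ℝ, ℝ) G z)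
    (hG' : ∀ z, f z = f x → ∀ v, dAt E F f z v = 0 → dAt E ℝ G z v = 0) :
    ∀ᶠ z in 𝓝 x, f z = f x → G z = G x := by
  have h := hf.isSubmersionAt x
  set φ := h.domChart
  set ψ := h.codChart
  have hx : x ∈ φ.source := h.mem_domChart_source
  have hφψ : φ.source ⊆ f ⁻¹' ψ.source := h.source_subset_preimage_source
  have hφs : ContMDiffOn 𝓘(ℝ, E) 𝓘(ℝ, E) ∞ φ.symm φ.target :=
    contMDiffOn_symm_of_mem_maximalAtlas h.domChart_mem_maximalAtlas
  -- In these charts `f` is the restriction of a linear map, so its fibres are pieces of parallel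
  -- affine subspaces.
  have hw : ∀ p ∈ φ.target, ψ (f (φ.symm p)) = (h.equiv p).1 := fun p hp =>
    h.writtenInCharts (by simpa using hp)
  obtain ⟨r, hr, hball⟩ := Metric.isOpen_iff.1 φ.open_target _ (φ.map_source hx)
  have hV : φ.source ∩ φ ⁻¹' Metric.ball (φ x) r ∈ 𝓝 x :=
    (φ.isOpen_inter_preimage Metric.isOpen_ball).mem_nhds ⟨hx, Metric.mem_ball_self hr⟩
  filter_upwards [hV] with z hz hzx
  -- The segment from `φ x` to `φ z` stays in the fibre because its direction is killed by the
  -- linear map. The derivative of `G` along it then vanishes.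
  set line : ℝ → E := fun t => φ x + t • (φ z - φ x) with hline
  have hlc : ContDiff ℝ ∞ line := contDiff_const.add (contDiff_id.smul contDiff_const)
  -- The parameters are those for which the line is in the ball, rather than `[0, 1]`: this set is
  -- open, convex, and contains both endpoints.
  set U : Set ℝ := line ⁻¹' Metric.ball (φ x) r with hU
  have hUo : IsOpen U := Metric.isOpen_ball.preimage hlc.continuous
  have hUc : IsPreconnected U := by
    have : U = AffineMap.lineMap (φ x) (φ z) ⁻¹' Metric.ball (φ x) r := by
      ext t; simp [hU, hline, AffineMap.lineMap_apply, add_comm]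
    rw [this]
    exact ((convex_ball (φ x) r).affine_preimage (AffineMap.lineMap (φ x) (φ z) : ℝ →ᵃ[ℝ] E)).isPreconnected
  have hUt : ∀ t ∈ U, line t ∈ φ.target := fun t ht => hball ht
  have heq : (h.equiv (φ z - φ x)).1 = 0 := by
    rw [map_sub, Prod.fst_sub, ← hw _ (φ.map_source hz.1), ← hw _ (φ.map_source hx),
      φ.left_inv hz.1, φ.left_inv hx, hzx, sub_self]
  have hfib : ∀ t ∈ U, f (φ.symm (line t)) = f x := by
    intro t ht
    refine ψ.injOn (hφψ (φ.map_target (hUt t ht))) (hφψ hx) ?_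
    rw [hw _ (hUt t ht)]
    conv_rhs => rw [← φ.left_inv hx]
    rw [hw _ (φ.map_source hx), hline]
    simp only [map_add, map_smul, Prod.fst_add, Prod.smul_fst, heq, smul_zero, add_zero]
  have hγ : ∀ t ∈ U, MDifferentiableAt 𝓘(ℝ, ℝ) 𝓘(ℝ, E) (φ.symm ∘ line) t := fun t ht =>
    (mdiffAt_of_smoothOn hφs φ.open_target (hUt t ht)).comp t
      (hlc.differentiable (by simp)).differentiableAt.mdifferentiableAt
  have hfγ : ∀ t ∈ U, dAt E F f ((φ.symm ∘ line) t) (dAt ℝ E (φ.symm ∘ line) t 1) = 0 := by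
    intro t ht
    have h1 := dAt_comp (g := f) (hf.contMDiff.contMDiffAt.mdifferentiableAt (by simp)) (hγ t ht)
    have h2 : dAt ℝ F (f ∘ (φ.symm ∘ line)) t = 0 := by
      have h3 : f ∘ (φ.symm ∘ line) =ᶠ[𝓝 t] fun _ => f x :=
        Filter.eventuallyEq_of_mem (hUo.mem_nhds ht) hfib
      rw [dAt_congr h3]
      exact mfderiv_const
    rw [h2] at h1
    exact (DFunLike.congr_fun h1 1).symm
  have hGd : ∀ t ∈ U, HasDerivAt (G ∘ φ.symm ∘ line) 0 t := by
    intro t ht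
    have hm := (hG _ (hfib t ht)).comp t (hγ t ht)
    have hd : DifferentiableAt ℝ (G ∘ φ.symm ∘ line) t := mdifferentiableAt_iff_differentiableAt.1 hm
    have h1 := dAt_comp (g := G) (f := φ.symm ∘ line) (hG _ (hfib t ht)) (hγ t ht)
    rw [dAt_eq_fderiv] at h1
    have h2 : deriv (G ∘ φ.symm ∘ line) t = 0 := by
      rw [← fderiv_apply_one_eq_deriv, h1]
      exact hG' _ (hfib t ht) _ (hfγ t ht)
    exact h2 ▸ hd.hasDerivAt
  have h0 : (0 : ℝ) ∈ U := by simpa [hU, hline] using hr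
  have h1 : (1 : ℝ) ∈ U := by
    have := hz.2
    simpa [hU, hline] using this
  have := hUo.is_const_of_deriv_eq_zero hUc
    (fun t ht => (hGd t ht).differentiableAt.differentiableWithinAt)
    (fun t ht => (hGd t ht).deriv) h1 h0
  simpa [hline, φ.left_inv hz.1, φ.left_inv hx] using this

/-- A function whose differential vanishes along a submersion is constant on connected fibres. -/
theorem eq_of_isSubmersion [IsManifold 𝓘(ℝ, E) ∞ M] [IsManifold 𝓘(ℝ, F) ∞ N]
    {f : M → N} (hf : Manifold.IsSubmersion 𝓘(ℝ, E) 𝓘(ℝ, F) ∞ f) {q : N}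
    (hq : IsPreconnected (f ⁻¹' {q})) {G : M → ℝ}
    (hG : ∀ z, f z = q → MDifferentiableAt 𝓘(ℝ, E) 𝓘(ℝ, ℝ) G z)
    (hG' : ∀ z, f z = q → ∀ v, dAt E F f z v = 0 → dAt E ℝ G z v = 0)
    {x y : M} (hx : f x = q) (hy : f y = q) : G x = G y := by
  have := isPreconnected_iff_preconnectedSpace.1 hq
  have hl : IsLocallyConstant fun z : f ⁻¹' {q} => G z := by
    rw [IsLocallyConstant.iff_eventually_eq]
    rintro ⟨z, rfl⟩
    have := ((continuous_subtype_val (p := (· ∈ f ⁻¹' {f z}))).tendsto ⟨z, rfl⟩).eventually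
      (eventually_eq_of_isSubmersionAt (x := z) hf hG hG')
    filter_upwards [this] with w hw
    exact hw w.2
  exact hl.apply_eq_of_preconnectedSpace ⟨x, hx⟩ ⟨y, hy⟩

end general

/-! ### Invariance of the Poincaré–Cartan form along Legendre fibres -/

variable {n m : ℕ} {X : Type v} {Y : Type u} [TopologicalSpace X] [ChartedSpace (Eu n) X]
  [TopologicalSpace Y] [ChartedSpace (Eu n × Eu m) Y] {π : Y → X}
  [IsManifold 𝓘(ℝ, Eu n) ∞ X] [hπ : IsSmoothFibreBundle (Eu n) m π]
  (L : Lagrangian n m π) (c : FibredChart n m π)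

theorem pt_eq_of_legendreMap_eq {z z' : Jet n m π} (h : legendreMap L z = legendreMap L z') :
    z.pt = z'.pt := congrArg LegendrePoint.pt h

theorem coordMomentum_eq_momCoord {z : Jet n m π} (hz : z.pt ∈ c.tot.source) :
    coordMomentum L c (c.jetHomeo z) =
      c.momCoord (legendreMap L z).pt (legendreMap L z).mom := by
  rw [legendreMap_mom L c hz]
  exact (c.momCoord_mkMom_self hz _).symm

theorem coordMomentum_eq_of_legendreMap_eq {z z' : Jet n m π}
    (h : legendreMap L z = legendreMap L z') (hz : z.pt ∈ c.tot.source) :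
    coordMomentum L c (c.jetHomeo z) = coordMomentum L c (c.jetHomeo z') := by
  rw [coordMomentum_eq_momCoord L c hz,
    coordMomentum_eq_momCoord L c (pt_eq_of_legendreMap_eq L h ▸ hz), h]

variable {k : ℕ} [ChartedSpace ((Eu n × Eu m) × Eu k) (ConstraintSpace L)]
    [IsManifold 𝓘(ℝ, (Eu n × Eu m) × Eu k) ∞ (ConstraintSpace L)]

variable {L}

/-- The energy `π^λ_i y^i_λ - ℒ` is constant on the fibres of the Legendre map of an almost regular
Lagrangian. -/
theorem coordLagrangian_sub_eq (hL : IsAlmostRegular k L) {z z' : Jet n m π}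
    (h : legendreMap L z = legendreMap L z') (hz : z.pt ∈ c.tot.source) :
    coordLagrangian L c (c.jetHomeo z) - coordMomentum L c (c.jetHomeo z) (c.jetHomeo z).2 =
    coordLagrangian L c (c.jetHomeo z') - coordMomentum L c (c.jetHomeo z) (c.jetHomeo z').2 := by
  set p := coordMomentum L c (c.jetHomeo z) with hp
  -- Minus the energy, with the momentum frozen at its value `p` at `z`. On the fibre through `z`
  -- nothing is lost, and differentiating `g` needs no second derivative of `ℒ`.
  let g : JetModel n m → ℝ := fun q => coordLagrangian L c q - p q.2
  have hfib : ∀ w, constraintMap L w = constraintMap L z → legendreMap L w = legendreMap L z :=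
    fun w hw => congrArg Subtype.val hw
  have hsrc : ∀ w, constraintMap L w = constraintMap L z → w.pt ∈ c.tot.source := fun w hw => by
    rw [pt_eq_of_legendreMap_eq L (hfib w hw)]; exact hz
  have hg : ∀ q ∈ c.jetHomeo.target, HasFDerivAt g (fderiv ℝ (coordLagrangian L c) q -
      p.comp (ContinuousLinearMap.snd ℝ (Eu n × Eu m) (Eu n →L[ℝ] Eu m))) q := fun q hq =>
    (differentiableAt_coordLagrangian L c hq).hasFDerivAt.sub
      (p.comp (ContinuousLinearMap.snd ℝ (Eu n × Eu m) (Eu n →L[ℝ] Eu m))).hasFDerivAt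
  have he : ∀ w, w.pt ∈ c.tot.source →
      MDifferentiableAt 𝓘(ℝ, JetModel n m) 𝓘(ℝ, JetModel n m) c.jetHomeo w := fun w hw =>
    mdiffAt_of_smoothOn c.jetHomeo_smooth c.jetHomeo.open_source hw
  refine eq_of_isSubmersion (G := g ∘ c.jetHomeo) hL.isSubmersion
    (hL.isConnected_fibre (constraintMap L z)).isPreconnected ?_ ?_ rfl (Subtype.ext h.symm)
  · intro w hw
    exact (hg _ (c.jetHomeo.map_source (hsrc w hw))).differentiableAt.mdifferentiableAt.comp w
      (he w (hsrc w hw))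
  · intro w hw v hv
    have hgw := hg _ (c.jetHomeo.map_source (hsrc w hw))
    rw [dAt_comp hgw.differentiableAt.mdifferentiableAt (he w (hsrc w hw)), dAt_eq_fderiv, hgw.fderiv]
    -- The projection `J¹Y → Y` factors through `N_L`, so a vector tangent to a Legendre fibre has
    -- only `y^i_λ` components.
    have hpt : dAt (JetModel n m) (Eu n × Eu m) (Jet.pt : Jet n m π → Y) w v = 0 := by
      have h1 := dAt_comp (f := constraintMap L) (x := w)
        (hL.isSmoothFibreBundle.contMDiff.contMDiffAt.mdifferentiableAt (by simp))
        (hL.isSubmersion.contMDiff.contMDiffAt.mdifferentiableAt (by simp))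
      have h2 := DFunLike.congr_fun h1 v
      rw [ContinuousLinearMap.comp_apply, hv, map_zero] at h2
      exact h2
    have h3 := DFunLike.congr_fun (c.dAt_tot_comp_dAt_pt (hsrc w hw)) v
    simp only [ContinuousLinearMap.comp_apply, hpt, map_zero, ContinuousLinearMap.coe_fst'] at h3
    set d := dAt (JetModel n m) (JetModel n m) c.jetHomeo w v with hd
    have h4 : d = ContinuousLinearMap.inr ℝ (Eu n × Eu m) (Eu n →L[ℝ] Eu m) d.2 := by
      rw [Prod.ext_iff]; exact ⟨h3.symm, rfl⟩
    have h5 : coordMomentum L c (c.jetHomeo w) = p :=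
      coordMomentum_eq_of_legendreMap_eq L c (hfib w hw) (hsrc w hw)
    change fderiv ℝ (coordLagrangian L c) (c.jetHomeo w) d - p d.2 = 0
    rw [← h5, sub_eq_zero]
    conv_lhs => rw [h4]
    rfl

/-- The Poincaré–Cartan form of an almost regular Lagrangian is invariant under the maps of `J¹Y`
which preserve the fibres of the Legendre map. -/
theorem pullback_poincareCartan (hL : IsAlmostRegular k L) {Φ : Jet n m π → Jet n m π}
    (hΦ : ContMDiff 𝓘(ℝ, JetModel n m) 𝓘(ℝ, JetModel n m) ∞ Φ)
    (hLΦ : ∀ z, legendreMap L (Φ z) = legendreMap L z) :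
    pullback (E := JetModel n m) (F := JetModel n m) Φ (poincareCartan L) = poincareCartan L := by
  funext z
  set c := fibredChartAt n m π z.pt
  have hz : z.pt ∈ c.tot.source := mem_fibredChartAt z.pt
  have hpt : (Φ z).pt = z.pt := pt_eq_of_legendreMap_eq L (hLΦ z)
  have hz' : (Φ z).pt ∈ c.tot.source := by rwa [hpt]
  have he : ∀ w : Jet n m π, w.pt ∈ c.tot.source →
      MDifferentiableAt 𝓘(ℝ, JetModel n m) 𝓘(ℝ, JetModel n m) c.jetHomeo w := fun w hw =>
    mdiffAt_of_smoothOn c.jetHomeo_smooth c.jetHomeo.open_source hw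
  -- `Φ` covers the identity of `Y`, so it preserves the `dx` and `dy` components of tangent
  -- vectors.
  have hfst : ∀ v, (dAt (JetModel n m) (JetModel n m) c.jetHomeo (Φ z)
      (dAt (JetModel n m) (JetModel n m) Φ z v)).1 =
      (dAt (JetModel n m) (JetModel n m) c.jetHomeo z v).1 := by
    intro v
    have h1 := DFunLike.congr_fun (c.dAt_tot_comp_dAt_pt hz) v
    have h2 := DFunLike.congr_fun (c.dAt_tot_comp_dAt_pt hz')
      (dAt (JetModel n m) (JetModel n m) Φ z v)
    have h3 := dAt_comp (g := (Jet.pt : Jet n m π → Y)) (f := Φ) (x := z)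
      (contMDiff_pt.contMDiffAt.mdifferentiableAt (by simp))
      (hΦ.contMDiffAt.mdifferentiableAt (by simp))
    have h4 : (Jet.pt : Jet n m π → Y) ∘ Φ = Jet.pt :=
      funext fun w => pt_eq_of_legendreMap_eq L (hLΦ w)
    rw [h4] at h3
    simp only [ContinuousLinearMap.comp_apply, ContinuousLinearMap.coe_fst'] at h1 h2
    rw [← h1, ← h2, h3, hpt]
    rfl
  ext v
  rw [pullback, poincareCartan_eq L c hz, poincareCartan_eq L c hz']
  simp only [ContinuousAlternatingMap.compContinuousLinearMap_apply, comp_def]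
  rw [coordPoincareCartan_apply, coordPoincareCartan_apply]
  simp only [hfst]
  set D := dAt (JetModel n m) (JetModel n m) c.jetHomeo z
  have hm := coordMomentum_eq_of_legendreMap_eq L c (hLΦ z) hz'
  have hl := coordLagrangian_sub_eq c hL (hLΦ z).symm hz
  rw [hm]
  set p := coordMomentum L c (c.jetHomeo z)
  -- Put `δ = y_λ(Φ z) - y_λ(z)`. Passing from `z` to `Φ z` changes `ℒ` by `p δ` by constancy of the
  -- energy, and the contact form by `-δ(dx)`. The latter contributes `-p δ` times the volume form,
  -- and the changes cancel.
  have ht := sum_slotForm_stdVol p ((c.jetHomeo (Φ z)).2 - (c.jetHomeo z).2) (fun i => (D (v i)).1.1)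
  have hl' : coordLagrangian L c (c.jetHomeo (Φ z)) = coordLagrangian L c (c.jetHomeo z) +
      p ((c.jetHomeo (Φ z)).2 - (c.jetHomeo z).2) := by
    rw [map_sub]; linarith
  rw [hl', add_mul, ← ht, add_assoc, ← Finset.sum_add_distrib]
  congr 1
  refine Finset.sum_congr rfl fun l _ => ?_
  rw [← Finset.sum_add_distrib]
  refine Finset.sum_congr rfl fun j _ => ?_
  rw [← add_mul, ← map_add]
  refine congrArg (· * _) (congrArg p ?_)
  ext1 a
  simp only [add_apply, ContinuousLinearMap.smulRight_apply, sub_apply, ← smul_add]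
  congr 1
  abel

end

section

/-! ### Lifting, pushing forward and extending vertical vectors -/

section general
variable {E F : Type*} [NormedAddCommGroup E] [NormedSpace ℝ E] [NormedAddCommGroup F]
  [NormedSpace ℝ F] {M N : Type*} [TopologicalSpace M] [ChartedSpace E M] [TopologicalSpace N]
  [ChartedSpace F N]

/-- In submersion charts `f` is a linear isomorphism followed by the projection to the first factor,
so a preimage of `v` is obtained by padding its coordinates with zero. -/
theorem surjective_dAt_of_isSubmersion {f : M → N}
    [IsManifold 𝓘(ℝ, E) ∞ M] [IsManifold 𝓘(ℝ, F) ∞ N]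
    (hf : Manifold.IsSubmersion 𝓘(ℝ, E) 𝓘(ℝ, F) ∞ f) (x : M) : Surjective (dAt E F f x) := by
  have h := hf.isSubmersionAt x
  set φ := h.domChart
  set ψ := h.codChart
  have hx : x ∈ φ.source := h.mem_domChart_source
  have hfx : f x ∈ ψ.source := h.mem_codChart_source
  have hφ : ContMDiffOn 𝓘(ℝ, E) 𝓘(ℝ, E) ∞ φ φ.source :=
    contMDiffOn_of_mem_maximalAtlas h.domChart_mem_maximalAtlas
  have hφs : ContMDiffOn 𝓘(ℝ, E) 𝓘(ℝ, E) ∞ φ.symm φ.target :=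
    contMDiffOn_symm_of_mem_maximalAtlas h.domChart_mem_maximalAtlas
  have hψ : ContMDiffOn 𝓘(ℝ, F) 𝓘(ℝ, F) ∞ ψ ψ.source :=
    contMDiffOn_of_mem_maximalAtlas h.codChart_mem_maximalAtlas
  have hψs : ContMDiffOn 𝓘(ℝ, F) 𝓘(ℝ, F) ∞ ψ.symm ψ.target :=
    contMDiffOn_symm_of_mem_maximalAtlas h.codChart_mem_maximalAtlas
  let A : E →L[ℝ] F := (ContinuousLinearMap.fst ℝ F h.complement).comp
    (h.equiv : E →L[ℝ] F × h.complement)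
  have hA : ∀ p ∈ φ.target, ψ (f (φ.symm p)) = A p := fun p hp =>
    h.writtenInCharts (by simpa using hp)
  have hw : ψ ∘ f =ᶠ[𝓝 x] A ∘ φ := by
    filter_upwards [φ.open_source.mem_nhds hx] with w hw
    have := hA _ (φ.map_source hw)
    rwa [φ.left_inv hw] at this
  have h1 : (dAt F F ψ (f x)).comp (dAt E F f x) = A.comp (dAt E E φ x) := by
    rw [← dAt_comp (mdiffAt_of_smoothOn hψ ψ.open_source hfx)
      (hf.contMDiff.contMDiffAt.mdifferentiableAt (by simp)), dAt_congr hw,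
      dAt_comp A.differentiableAt.mdifferentiableAt (mdiffAt_of_smoothOn hφ φ.open_source hx),
      dAt_eq_fderiv, A.fderiv]
  intro v
  refine ⟨dAt E E φ.symm (φ x) (h.equiv.symm (dAt F F ψ (f x) v, 0)), ?_⟩
  have h2 := fun v => DFunLike.congr_fun (dAt_symm_comp ψ hψ hψs hfx) v
  have h3 := fun v => DFunLike.congr_fun (dAt_comp_symm φ hφ hφs hx) v
  simp only [ContinuousLinearMap.comp_apply, ContinuousLinearMap.id_apply] at h2 h3
  rw [← h2 (dAt E F f x _), ← ContinuousLinearMap.comp_apply (dAt F F ψ (f x)), h1,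
    ContinuousLinearMap.comp_apply, h3]
  simp [A, h2]

variable {n : ℕ} {X : Type*} [TopologicalSpace X] [ChartedSpace (Eu n) X]

/-- A vertical field on the total space of a fibration with a section `Ψ` pushes forward to a
vertical field on the base. -/
theorem IsVerticalField.pushforward [IsManifold 𝓘(ℝ, E) ∞ M] [IsManifold 𝓘(ℝ, F) ∞ N]
    {p : M → X} {p' : N → X} {f : M → N} {Ψ : N → M}
    (hf : ContMDiff 𝓘(ℝ, E) 𝓘(ℝ, F) ∞ f) (hΨ : ContMDiff 𝓘(ℝ, F) 𝓘(ℝ, E) ∞ Ψ)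
    (hfΨ : ∀ q, f (Ψ q) = q) (hp' : ContMDiff 𝓘(ℝ, F) 𝓘(ℝ, Eu n) ∞ p') (hp : ∀ z, p' (f z) = p z)
    {u : ∀ z : M, TangentSpace 𝓘(ℝ, E) z} (hu : IsVerticalField n p u) :
    IsVerticalField (E := F) n p' (fun q => (dAt E F f (Ψ q) (u (Ψ q)) : F)) where
  contMDiff := by
    have h1 := (hf.contMDiff_tangentMap (m := ∞) (by simp)).comp (hu.contMDiff.comp hΨ)
    -- The composite `Tf ∘ u ∘ Ψ` takes its value over `f (Ψ q)`, which is only propositionally `q`;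
    -- the base point has to be transported.
    have h2 : ∀ (q q' : N) (v : F), q' = q →
        (⟨q', v⟩ : TangentBundle 𝓘(ℝ, F) N) = ⟨q, v⟩ := by
      rintro q _ v rfl; rfl
    refine h1.congr fun q => ?_
    exact (h2 q (f (Ψ q)) (dAt E F f (Ψ q) (u (Ψ q))) (hfΨ q)).symm
  vertical q := by
    have h1 := dAt_comp (g := p') (f := f) (x := Ψ q)
      (hp'.contMDiffAt.mdifferentiableAt (by simp)) (hf.contMDiffAt.mdifferentiableAt (by simp))
    have h2 : p' ∘ f = p := funext hp
    rw [h2, hfΨ q] at h1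
    exact (DFunLike.congr_fun h1 (u (Ψ q))).symm.trans (hu.vertical (Ψ q))

end general

variable {n m : ℕ} {X : Type v} {Y : Type u} [TopologicalSpace X] [ChartedSpace (Eu n) X]
  [TopologicalSpace Y] [ChartedSpace (Eu n × Eu m) Y] {π : Y → X}
  [IsManifold 𝓘(ℝ, Eu n) ∞ X] [hπ : IsSmoothFibreBundle (Eu n) m π]

/-- Jets over different points are separated by their projections to `Y`; jets over the same point
lie in a common adapted chart. Hausdorffness makes bump functions on `J¹Y`, extended by zero,
smooth. -/
theorem t2Space_jet [T2Space Y] : T2Space (Jet n m π) := by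
  refine ⟨fun z z' hne => ?_⟩
  by_cases h : z.pt = z'.pt
  · set e := (fibredChartAt n m π z.pt).jetHomeo
    have hz : z ∈ e.source := mem_fibredChartAt z.pt
    have hz' : z' ∈ e.source := by
      change z'.pt ∈ (fibredChartAt n m π z.pt).tot.source
      rw [← h]; exact mem_fibredChartAt z.pt
    obtain ⟨U, V, hU, hV, h1, h2, h3⟩ := t2_separation (e.injOn.ne hz hz' hne)
    exact ⟨_, _, e.isOpen_inter_preimage hU, e.isOpen_inter_preimage hV, ⟨hz, h1⟩, ⟨hz', h2⟩,
      (h3.preimage e).mono inter_subset_right inter_subset_right⟩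
  · exact separated_by_continuous contMDiff_pt.continuous h

/-- Every vertical tangent vector of `J¹Y → X` extends to a vertical vector field. -/
theorem exists_isVerticalField_jet [T2Space Y] (z : Jet n m π) (w : JetModel n m)
    (hw : dAt (JetModel n m) (Eu n) (fun z : Jet n m π => π z.pt) z w = 0) :
    ∃ u : ∀ z : Jet n m π, TangentSpace 𝓘(ℝ, JetModel n m) z,
      IsVerticalField n (fun z : Jet n m π => π z.pt) u ∧ u z = w := by
  have : T2Space (Jet n m π) := t2Space_jet
  set c := fibredChartAt n m π z.pt with hc
  have hz : z ∈ c.jetHomeo.source := mem_fibredChartAt z.pt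
  set w' : JetModel n m := dAt (JetModel n m) (JetModel n m) c.jetHomeo z w with hw'
  have hw1 : w'.1.1 = 0 := by
    have h1 := DFunLike.congr_fun (c.dAt_tot_comp_dAt_pt hz) w
    have h2 := DFunLike.congr_fun (c.fst_comp_dAt hz)
      (dAt (JetModel n m) (Eu n × Eu m) (Jet.pt : Jet n m π → Y) z w)
    have h3 := dAt_comp (g := π) (f := (Jet.pt : Jet n m π → Y)) (x := z)
      (hπ.contMDiff.contMDiffAt.mdifferentiableAt (by simp))
      (contMDiff_pt.contMDiffAt.mdifferentiableAt (by simp))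
    have h4 : dAt (Eu n × Eu m) (Eu n) π z.pt
        (dAt (JetModel n m) (Eu n × Eu m) (Jet.pt : Jet n m π → Y) z w) = 0 :=
      (DFunLike.congr_fun h3 w).symm.trans hw
    simp only [ContinuousLinearMap.comp_apply, ContinuousLinearMap.coe_fst', h4, map_zero] at h1 h2
    rw [hw', ← h1, h2]
  let T := trivializationAt (JetModel n m) (TangentSpace 𝓘(ℝ, JetModel n m) : Jet n m π → Type _) z
  -- The field with constant components `w'` in the adapted chart at `z`, later cut off by the bump
  -- function `b`.
  let σ : ∀ y : Jet n m π, TangentSpace 𝓘(ℝ, JetModel n m) y := fun y => T.symmL ℝ y w'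
  have hbase : T.baseSet = c.jetHomeo.source := TangentBundle.trivializationAt_baseSet z
  have hσ : ∀ y ∈ c.jetHomeo.source,
      σ y = dAt (JetModel n m) (JetModel n m) c.jetHomeo.symm (c.jetHomeo y) w' := by
    intro y hy
    have h1 := TangentBundle.symmL_trivializationAt (I := 𝓘(ℝ, JetModel n m)) (x₀ := z) (x := y) hy
    have h2 := DFunLike.congr_fun h1 w'
    rw [modelWithCornersSelf_coe, range_id, mfderivWithin_univ] at h2
    refine h2.trans ?_
    rfl
  have hσs : ContMDiffOn 𝓘(ℝ, JetModel n m) 𝓘(ℝ, JetModel n m).tangent ∞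
      (fun y => (⟨y, σ y⟩ : TangentBundle 𝓘(ℝ, JetModel n m) (Jet n m π))) T.baseSet := by
    refine (T.contMDiffOn_section_baseSet_iff (IB := 𝓘(ℝ, JetModel n m)) (n := ∞) (s := σ)).2 ?_
    refine (contMDiffOn_const (c := w')).congr fun y hy => ?_
    have h1 := congrArg Prod.snd (T.apply_mk_symm hy w')
    rw [← T.symmL_apply (R := ℝ) hy] at h1
    exact h1
  let b : SmoothBumpFunction 𝓘(ℝ, JetModel n m) z := Classical.arbitrary _
  refine ⟨fun y => b y • σ y, ⟨?_, ?_⟩, ?_⟩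
  · exact ContMDiffOn.smul_section_of_tsupport (ψ := b) (s := σ) b.contMDiff.contMDiffOn
      T.open_baseSet (by rw [hbase]; exact b.tsupport_subset_chartAt_source) hσs
  · intro y
    by_cases hy : y ∈ c.jetHomeo.source
    · have hyt := c.jetHomeo.map_source hy
      -- In the chart the projection to `X` sees only the `x` coordinates, and `w'` has none, so the
      -- constant field is vertical on the whole chart domain.
      have hp : (fun z : Jet n m π => π z.pt) ∘ c.jetHomeo.symm =ᶠ[𝓝 (c.jetHomeo y)]
          c.base.symm ∘ ((ContinuousLinearMap.fst ℝ (Eu n) (Eu m)).comp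
            (ContinuousLinearMap.fst ℝ (Eu n × Eu m) (Eu n →L[ℝ] Eu m))) := by
        filter_upwards [c.jetHomeo.open_target.mem_nhds hyt] with q hq
        have h1 := c.proj_eq (c.jetHomeo.map_target hq)
        have h2 : c.tot (c.jetHomeo.symm q).pt = q.1 := by
          rw [← c.fst_jetHomeo, c.jetHomeo.right_inv hq]
        rw [h2] at h1
        exact h1
      have h1 := dAt_comp (g := fun z : Jet n m π => π z.pt) (f := c.jetHomeo.symm)
        (x := c.jetHomeo y) (contMDiff_proj_pt.contMDiffAt.mdifferentiableAt (by simp))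
        (mdiffAt_of_smoothOn c.jetHomeo_symm_smooth c.jetHomeo.open_target hyt)
      rw [dAt_congr hp, c.jetHomeo.left_inv hy, dAt_comp
        (mdiffAt_of_smoothOn c.base_symm_smooth c.base.open_target (by
          change (c.tot y.pt).1 ∈ _
          rw [c.fst_tot _ hy]; exact c.base.map_source (c.proj_mem _ hy)))
        (ContinuousLinearMap.differentiableAt _).mdifferentiableAt, dAt_eq_fderiv (E := JetModel n m),
        ContinuousLinearMap.fderiv] at h1
      have h2 := DFunLike.congr_fun h1 w'
      simp only [ContinuousLinearMap.comp_apply, ContinuousLinearMap.coe_fst', hw1, map_zero] at h2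
      rw [← hσ y hy] at h2
      change dAt (JetModel n m) (Eu n) (fun z : Jet n m π => π z.pt) y ((b y : ℝ) • (σ y : JetModel n m)) = 0
      exact (map_smul (dAt (JetModel n m) (Eu n) (fun z : Jet n m π => π z.pt) y) (b y)
        (σ y : JetModel n m)).trans ((congrArg (b y • ·) h2.symm).trans (smul_zero _))
    · have hb : b y = 0 := by
        by_contra h
        exact hy (b.support_subset_source h)
      simp [hb]
  · change b z • σ z = w
    rw [b.eq_one, one_smul, hσ z hz]
    exact DFunLike.congr_fun (dAt_symm_comp _ c.jetHomeo_smooth c.jetHomeo_symm_smooth hz) w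

end

end JetField

/-! ### The equivalence of the two systems -/

open JetField
theorem theorem3p01 {n m k : ℕ}
    {X : Type*} [TopologicalSpace X] [T2Space X] [SecondCountableTopology X] [ConnectedSpace X]
    [ChartedSpace (Eu n) X] [IsManifold 𝓘(ℝ, Eu n) ∞ X]
    {Y : Type*} [TopologicalSpace Y] [T2Space Y] [SecondCountableTopology Y] [ConnectedSpace Y]
    [ChartedSpace (Eu n × Eu m) Y] [IsManifold 𝓘(ℝ, Eu n × Eu m) ∞ Y]
    (π : Y → X) [IsSmoothFibreBundle (Eu n) m π]
    (L : Lagrangian n m π)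
    [ChartedSpace ((Eu n × Eu m) × Eu k) (ConstraintSpace L)]
    [IsManifold 𝓘(ℝ, (Eu n × Eu m) × Eu k) ∞ (ConstraintSpace L)]
    (hL : IsAlmostRegular k L)
    (Ψ : ConstraintSpace L → Jet n m π)
    (hΨ : ContMDiff 𝓘(ℝ, (Eu n × Eu m) × Eu k) 𝓘(ℝ, JetModel n m) ∞ Ψ)
    (hΨ' : ∀ q, constraintMap L (Ψ q) = q)
    (s : X → Jet n m π) (hs : IsSmoothSection n (JetModel n m) (fun z : Jet n m π => π z.pt) s) :
    SolvesCartan L s ↔ SolvesConstrainedHamilton k L Ψ (constraintMap L ∘ s) := by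
  have hf : ContMDiff 𝓘(ℝ, JetModel n m) 𝓘(ℝ, (Eu n × Eu m) × Eu k) ∞ (constraintMap L) :=
    hL.isSubmersion.contMDiff
  have hp' : ContMDiff 𝓘(ℝ, (Eu n × Eu m) × Eu k) 𝓘(ℝ, Eu n) ∞
      (fun q : ConstraintSpace L => π q.1.pt) :=
    (IsSmoothFibreBundle.contMDiff (k := m) (p := π)).comp hL.isSmoothFibreBundle.contMDiff
  have hfd : ∀ z, MDifferentiableAt 𝓘(ℝ, JetModel n m) 𝓘(ℝ, (Eu n × Eu m) × Eu k)
      (constraintMap L) z := fun z => hf.contMDiffAt.mdifferentiableAt (by simp)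
  have hpd : ∀ q : ConstraintSpace L, MDifferentiableAt 𝓘(ℝ, (Eu n × Eu m) × Eu k) 𝓘(ℝ, Eu n)
      (fun q : ConstraintSpace L => π q.1.pt) q :=
    fun q => hp'.contMDiffAt.mdifferentiableAt (by simp)
  have hproj : ∀ z v, dAt (JetModel n m) (Eu n) (fun z : Jet n m π => π z.pt) z v =
      dAt ((Eu n × Eu m) × Eu k) (Eu n) (fun q : ConstraintSpace L => π q.1.pt) (constraintMap L z)
        (dAt (JetModel n m) ((Eu n × Eu m) × Eu k) (constraintMap L) z v) := fun z v =>
    DFunLike.congr_fun (dAt_comp (f := constraintMap L) (hpd _) (hfd z)) v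
  have hr : IsSmoothSection n ((Eu n × Eu m) × Eu k) (fun q : ConstraintSpace L => π q.1.pt)
      (constraintMap L ∘ s) := ⟨hf.comp hs.contMDiff, hs.proj_apply⟩
  -- `dH_L` is the pull-back of `dH_N` by the Legendre map. Both sides are expressed through `dH_L`
  -- at `Ψ (L̂ z)`, so differentiability is needed for `H_L` only, not for `H_N`.
  have hd : ∀ z : Jet n m π, extDerivAt (poincareCartan L) z =
      (extDerivAt (pullback (E := (Eu n × Eu m) × Eu k) (F := JetModel n m) Ψ (poincareCartan L))
        (constraintMap L z)).compContinuousLinearMap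
        (dAt (JetModel n m) ((Eu n × Eu m) × Eu k) (constraintMap L) z) := by
    intro z
    have hΦ := hΨ.comp hf
    have h1 := pullback_poincareCartan hL hΦ (fun z => congrArg Subtype.val (hΨ' (constraintMap L z)))
    have hdiff := differentiableAt_poincareCartan L
      (fibredChartAt n m π ((Ψ ∘ constraintMap L) z).pt)
      ((FibredChart.jetHomeo _).map_source (mem_fibredChartAt ((Ψ ∘ constraintMap L) z).pt))
    have h2 := extDerivAt_pullback hΦ (H := poincareCartan L) (x := z) hdiff
    have h3 := extDerivAt_pullback hΨ (H := poincareCartan L) (x := constraintMap L z) hdiff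
    rw [h1, dAt_comp (hΨ.contMDiffAt.mdifferentiableAt (by simp)) (hfd z)] at h2
    rw [h2, h3]
    rfl
  have heq : ∀ (x : X) (v : JetModel n m),
      ((extDerivAt (poincareCartan L) (s x)).curryLeft v).compContinuousLinearMap
        (dAt (Eu n) (JetModel n m) s x) =
      ((extDerivAt (pullback (E := (Eu n × Eu m) × Eu k) (F := JetModel n m) Ψ (poincareCartan L))
        ((constraintMap L ∘ s) x)).curryLeft
          (dAt (JetModel n m) ((Eu n × Eu m) × Eu k) (constraintMap L) (s x) v)).compContinuousLinearMap
        (dAt (Eu n) ((Eu n × Eu m) × Eu k) (constraintMap L ∘ s) x) := by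
    intro x v
    rw [dAt_comp (hfd _) (hs.contMDiff.contMDiffAt.mdifferentiableAt (by simp)), hd]
    ext a
    simp only [ContinuousAlternatingMap.compContinuousLinearMap_apply,
      ContinuousAlternatingMap.curryLeft_apply_apply, comp_def]
    congr 1
    ext1 i
    refine Fin.cases ?_ (fun i => ?_) i <;> rfl
  constructor
  · refine fun h => ⟨hr, fun u hu x => ?_⟩
    -- Only the value of `u` at `r x` matters, so it suffices to lift that single vector to `s x`
    -- and extend the lift; no lift of the whole field is needed.
    obtain ⟨w, hw⟩ := surjective_dAt_of_isSubmersion hL.isSubmersion (s x)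
      (u (constraintMap L (s x)))
    obtain ⟨U, hU, hUw⟩ := exists_isVerticalField_jet (s x) w
      ((hproj _ _).trans (by rw [hw]; exact hu.vertical _))
    have := h.equation U hU x
    rw [hUw] at this
    rw [heq x w, hw] at this
    exact this
  · refine fun h => ⟨hs, fun u hu x => ?_⟩
    set z := s x with hz
    set v := dAt (JetModel n m) ((Eu n × Eu m) × Eu k) (constraintMap L) z (u z) with hv
    have hv0 : dAt ((Eu n × Eu m) × Eu k) (Eu n) (fun q : ConstraintSpace L => π q.1.pt)
        (constraintMap L z) v = 0 := (hproj _ _).symm.trans (hu.vertical z)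
    -- The lift is taken at `Ψ (L̂ z)`, which need not be `z`: the pushed-forward field at `L̂ z`
    -- reads the field on `J¹Y` at that point, and so takes the value `v` there.
    obtain ⟨w, hw⟩ := surjective_dAt_of_isSubmersion hL.isSubmersion (Ψ (constraintMap L z)) v
    obtain ⟨U, hU, hUw⟩ := exists_isVerticalField_jet (Ψ (constraintMap L z)) w
      ((hproj _ _).trans (by rw [hw, hΨ']; exact hv0))
    have := h.equation _ (hU.pushforward hf hΨ hΨ' hp' fun _ => rfl) x
    refine (heq x (u z)).trans ?_
    rw [← hv, ← hw, ← hUw]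
    exact this
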